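/- Let $H$ be a complex Hilbert space, $A$ a bounded operator on $H$ and $U$ a unitary operator on $H$. For $\mu\in\mathbb{C}$ with $\operatorname{Im}\mu\neq 0$ put $R_U(\mu)=(Ue^{-i\mu}-1)^{-1}$. Let $\mathbb{T}=\mathbb{R}/2\pi\mathbb{Z}$, identified with $[0,2\pi)$ and equipped with Lebesgue measure; let $1_{[a,b)}(U)$ denote the spectral projection of $U$ for the arc $\{e^{i\theta}: a\le\theta<b\}$, and let $\ell^2(\mathbb{Z},H)$ carry the norm $\|u\|^2=\sum_{t\in\mathbb{Z}}\|u(t)\|_H^2$. Consider the following four quantities in $[0,\infty]$ (suprema over the empty set being $0$): 1. $\displaystyle\frac{1}{2\pi}\,\|AU^{\,\cdot}\|^2_{\mathcal{L}(H,\ell^2(\mathbb{Z},H))}=\frac1{2\pi}\sup_{\|\varphi\|_H=1}\sum_{t\in\mathbb{Z}}\|AU^t\varphi\|_H^2$; 2. $\displaystyle\frac{1}{4\pi^2}\sup_{\epsilon\in\mathbb{R}\setminus\{0\},\ \|\varphi\|_H=1}\Bigl(\|AR_U(\cdot+i\epsilon)\varphi\|^2_{L^2(\mathbb{T},H)}+\|AR_U(\cdot-i\epsilon)\varphi\|^2_{L^2(\mathbb{T},H)}\Bigr)$;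 3. $\displaystyle\frac{1}{2\pi}\sup_{\operatorname{Im}\mu\neq0}\bigl\|A\bigl(R_U(\mu)-R_U(\overline{\mu})\bigr)A^*\bigr\|_{\mathcal{L}(H)}$; 4. $\displaystyle\sup_{a<b\le a+2\pi}\frac{\|A\,1_{[a,b)}(U)\|^2_{\mathcal{L}(H)}}{|b-a|}$. If one of these quantities is finite, then all of them are finite, and in that case they are all equal. In other words, the four quantities are equal as elements of $[0,\infty]$. -/

import Mathlib

open MeasureTheory
open scoped ENNReal InnerProductSpace CompactlySupported

namespace KatoUnitary

noncomputable section

variable {H : Type*} [NormedAddCommGroup H] [InnerProductSpace ℂ H] [CompleteSpace H]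

/-! ### Spectral measures and spectral projections of a unitary operator -/

/-- `f(U)` for a real continuous function `f` on the spectrum of `U`
(continuous functional calculus). -/
def contCalc (U : unitary (H →L[ℂ] H)) (f : C(spectrum ℂ (U : H →L[ℂ] H), ℝ)) : H →L[ℂ] H :=
  cfcHom (R := ℂ) (a := (U : H →L[ℂ] H)) (p := IsStarNormal) inferInstance
    ((⟨Complex.ofReal, Complex.continuous_ofReal⟩ : C(ℝ, ℂ)).comp f)

lemma contCalc_add (U : unitary (H →L[ℂ] H)) (f g : C(spectrum ℂ (U : H →L[ℂ] H), ℝ)) :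
    contCalc U (f + g) = contCalc U f + contCalc U g := by
  unfold contCalc
  rw [← map_add]
  congr 1
  ext x
  simp

lemma contCalc_smul (U : unitary (H →L[ℂ] H)) (c : ℝ)
    (f : C(spectrum ℂ (U : H →L[ℂ] H), ℝ)) :
    contCalc U (c • f) = (c : ℂ) • contCalc U f := by
  unfold contCalc
  rw [← map_smul]
  congr 1
  ext x
  simp

lemma contCalc_one (U : unitary (H →L[ℂ] H)) : contCalc U 1 = 1 := by
  unfold contCalc
  rw [← map_one (cfcHom (R := ℂ) (a := (U : H →L[ℂ] H)) (p := IsStarNormal) inferInstance)]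
  congr 1

lemma contCalc_mul (U : unitary (H →L[ℂ] H)) (f g : C(spectrum ℂ (U : H →L[ℂ] H), ℝ)) :
    contCalc U (f * g) = contCalc U f * contCalc U g := by
  unfold contCalc
  rw [← map_mul]
  congr 1
  ext x
  simp

lemma contCalc_star (U : unitary (H →L[ℂ] H)) (f : C(spectrum ℂ (U : H →L[ℂ] H), ℝ)) :
    star (contCalc U f) = contCalc U f := by
  unfold contCalc
  rw [← map_star]
  congr 1
  ext x
  simp

lemma contCalc_inner_comm (U : unitary (H →L[ℂ] H)) (f : C(spectrum ℂ (U : H →L[ℂ] H), ℝ))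
    (x y : H) : ⟪contCalc U f x, y⟫_ℂ = ⟪x, contCalc U f y⟫_ℂ := by
  conv_rhs => rw [← contCalc_star U f]
  rw [ContinuousLinearMap.star_eq_adjoint, ContinuousLinearMap.adjoint_inner_right]

lemma contCalc_nonneg (U : unitary (H →L[ℂ] H)) (f : C(spectrum ℂ (U : H →L[ℂ] H), ℝ))
    (hf : 0 ≤ f) (φ : H) : 0 ≤ (⟪φ, contCalc U f φ⟫_ℂ).re := by
  let g : C(spectrum ℂ (U : H →L[ℂ] H), ℝ) := ⟨fun x => Real.sqrt (f x), by fun_prop⟩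
  have h : f = g * g := by
    ext x
    exact (Real.mul_self_sqrt (hf x)).symm
  rw [h, contCalc_mul, mul_apply_eq_comp, ← contCalc_inner_comm]
  exact inner_self_nonneg (𝕜 := ℂ)

/-- The positive functional `f ↦ ⟨φ, f(U) φ⟩`. -/
def spectralFunctional (U : unitary (H →L[ℂ] H)) (φ : H) :
    C_c(spectrum ℂ (U : H →L[ℂ] H), ℝ) →ₚ[ℝ] ℝ :=
  PositiveLinearMap.mk₀
    { toFun := fun f => (⟪φ, contCalc U f.toContinuousMap φ⟫_ℂ).re
      map_add' := fun f g => by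
        have h : (f + g).toContinuousMap = f.toContinuousMap + g.toContinuousMap := rfl
        rw [h, contCalc_add, add_apply, inner_add_right, Complex.add_re]
      map_smul' := fun c f => by
        have h : (c • f).toContinuousMap = c • f.toContinuousMap := rfl
        rw [h, contCalc_smul, smul_apply, inner_smul_right]
        simp }
    (fun f hf => contCalc_nonneg U f.toContinuousMap (fun x => hf x) φ)

/-- The spectral measure of `U` with respect to `φ`: the Borel measure on the spectrum with
`∫ f dμ = ⟨φ, f(U) φ⟩` for all continuous `f` (Riesz representation theorem). -/
def spectralMeasure (U : unitary (H →L[ℂ] H)) (φ : H) :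
    Measure (spectrum ℂ (U : H →L[ℂ] H)) :=
  RealRMK.rieszMeasure (spectralFunctional U φ)

instance (U : unitary (H →L[ℂ] H)) (φ : H) : IsFiniteMeasure (spectralMeasure U φ) := by
  unfold spectralMeasure
  infer_instance

lemma integral_spectralMeasure (U : unitary (H →L[ℂ] H)) (φ : H)
    (f : C(spectrum ℂ (U : H →L[ℂ] H), ℝ)) :
    ((∫ z, f z ∂(spectralMeasure U φ) : ℝ) : ℂ) = ⟪φ, contCalc U f φ⟫_ℂ := by
  have h := RealRMK.integral_rieszMeasure (spectralFunctional U φ)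
    ⟨f, HasCompactSupport.of_compactSpace _⟩
  have h2 : ∫ z, f z ∂(spectralMeasure U φ) = (⟪φ, contCalc U f φ⟫_ℂ).re := h
  rw [h2]
  apply Complex.conj_eq_iff_re.mp
  rw [inner_conj_symm, contCalc_inner_comm]

/-- A relation among quadratic expressions `⟨v, T v⟩` passes to the spectral measures. -/
lemma sum_spectralMeasure_eq_zero (U : unitary (H →L[ℂ] H)) {ι : Type} [Fintype ι]
    (c : ι → ℂ) (v : ι → H) (h : ∀ T : H →L[ℂ] H, ∑ j, c j * ⟪v j, T (v j)⟫_ℂ = 0)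
    {E : Set (spectrum ℂ (U : H →L[ℂ] H))} (hE : MeasurableSet E) :
    ∑ j, c j * ((spectralMeasure U (v j)).real E : ℂ) = 0 := by
  rw [← norm_le_zero_iff]
  have key : ∀ ε : ℝ, 0 < ε →
      ‖∑ j, c j * ((spectralMeasure U (v j)).real E : ℂ)‖ ≤ (∑ j, ‖c j‖) * ε := by
    classical
    intro ε hε
    set ν : Measure (spectrum ℂ (U : H →L[ℂ] H)) := ∑ j, spectralMeasure U (v j) with hν
    have hνint : Integrable (E.indicator (fun _ => (1 : ℝ))) ν :=
      (integrable_const (1 : ℝ)).indicator hE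
    obtain ⟨f, hf, hfi⟩ := hνint.exists_boundedContinuous_integral_sub_le hε
    have hle : ∀ j, spectralMeasure U (v j) ≤ ν := fun j => by
      rw [hν, ← Finset.add_sum_erase _ _ (Finset.mem_univ j)]
      exact Measure.le_add_right le_rfl
    have h0 := h (contCalc U f.toContinuousMap)
    have h1 : ∑ j, c j * ((∫ z, f z ∂(spectralMeasure U (v j)) : ℝ) : ℂ) = 0 := by
      rw [← h0]
      refine Finset.sum_congr rfl fun j _ => ?_
      rw [← integral_spectralMeasure]
      rfl
    calc ‖∑ j, c j * ((spectralMeasure U (v j)).real E : ℂ)‖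
        = ‖∑ j, c j * (((spectralMeasure U (v j)).real E
            - ∫ z, f z ∂(spectralMeasure U (v j)) : ℝ) : ℂ)‖ := by
          congr 1
          rw [← sub_zero (∑ j, c j * ((spectralMeasure U (v j)).real E : ℂ)), ← h1,
            ← Finset.sum_sub_distrib]
          refine Finset.sum_congr rfl fun j _ => ?_
          push_cast
          ring
      _ ≤ ∑ j, ‖c j‖ * ε := by
          refine norm_sum_le_of_le _ fun j _ => ?_
          rw [norm_mul, Complex.norm_real]
          refine mul_le_mul_of_nonneg_left ?_ (norm_nonneg _)
          have i1 : Integrable (E.indicator (fun _ => (1 : ℝ))) (spectralMeasure U (v j)) :=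
            hνint.mono_measure (hle j)
          have i2 : Integrable f (spectralMeasure U (v j)) := hfi.mono_measure (hle j)
          have e1 : (spectralMeasure U (v j)).real E
              = ∫ z, E.indicator (fun _ => (1 : ℝ)) z ∂(spectralMeasure U (v j)) := by
            rw [integral_indicator hE]
            simp
          rw [e1, ← integral_sub i1 i2]
          refine (norm_integral_le_integral_norm _).trans (le_trans ?_ hf)
          exact integral_mono_measure (hle j) (Filter.Eventually.of_forall fun _ => norm_nonneg _)
            (hνint.sub hfi).norm
      _ = (∑ j, ‖c j‖) * ε := by rw [Finset.sum_mul]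
  have hS : 0 ≤ ∑ j, ‖c j‖ := Finset.sum_nonneg fun j _ => norm_nonneg _
  refine le_of_forall_pos_le_add fun δ hδ => ?_
  refine (key (δ / (∑ j, ‖c j‖ + 1)) (by positivity)).trans ?_
  rw [zero_add, mul_div_assoc', div_le_iff₀ (by positivity)]
  nlinarith

/-- The sesquilinear form obtained by polarization of `φ ↦ μ_φ(E)`. -/
def spectralForm (U : unitary (H →L[ℂ] H)) (E : Set (spectrum ℂ (U : H →L[ℂ] H)))
    (x y : H) : ℂ :=
  (1 / 4) * (((spectralMeasure U (x + y)).real E : ℂ)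
    - ((spectralMeasure U (x - y)).real E : ℂ)
    - Complex.I * ((spectralMeasure U (x + Complex.I • y)).real E : ℂ)
    + Complex.I * ((spectralMeasure U (x - Complex.I • y)).real E : ℂ))

lemma sum_spectralForm_eq_zero (U : unitary (H →L[ℂ] H)) {ι : Type} [Fintype ι]
    (a : ι → ℂ) (x y : ι → H) (h : ∀ T : H →L[ℂ] H, ∑ j, a j * ⟪x j, T (y j)⟫_ℂ = 0)
    {E : Set (spectrum ℂ (U : H →L[ℂ] H))} (hE : MeasurableSet E) :
    ∑ j, a j * spectralForm U E (x j) (y j) = 0 := by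
  have hk := sum_spectralMeasure_eq_zero U (ι := ι × Fin 4)
    (fun p => a p.1 * ![1 / 4, -1 / 4, -Complex.I / 4, Complex.I / 4] p.2)
    (fun p => x p.1 + (![1, -1, Complex.I, -Complex.I] p.2 : ℂ) • y p.1) ?_ hE
  · rw [← hk, Fintype.sum_prod_type]
    refine Finset.sum_congr rfl fun j _ => ?_
    simp only [Fin.sum_univ_four, spectralForm]
    simp [sub_eq_add_neg]
    ring
  · intro T
    rw [← h T, Fintype.sum_prod_type]
    refine Finset.sum_congr rfl fun j _ => ?_
    simp only [Fin.sum_univ_four]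
    simp [inner_add_left, inner_smul_left, inner_smul_right]
    linear_combination (-(1 / 2) * a j * ⟪x j, T (y j)⟫_ℂ
      + (1 / 2) * a j * ⟪y j, T (x j)⟫_ℂ) * Complex.I_mul_I

lemma spectralForm_self (U : unitary (H →L[ℂ] H))
    {E : Set (spectrum ℂ (U : H →L[ℂ] H))} (hE : MeasurableSet E) (x : H) :
    spectralForm U E x x = ((spectralMeasure U x).real E : ℂ) := by
  have hk := sum_spectralMeasure_eq_zero U (ι := Fin 5)
    ![1 / 4, -1 / 4, -Complex.I / 4, Complex.I / 4, -1]
    (fun p => (![2, 0, 1 + Complex.I, 1 - Complex.I, 1] p : ℂ) • x) ?_ hE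
  · rw [Fin.sum_univ_five] at hk
    simp only [Matrix.cons_val, add_smul, sub_smul, one_smul, zero_smul, two_smul] at hk
    rw [spectralForm, sub_self]
    linear_combination hk
  · intro T
    rw [Fin.sum_univ_five]
    simp
    ring

lemma spectralMeasure_real_le (U : unitary (H →L[ℂ] H))
    (E : Set (spectrum ℂ (U : H →L[ℂ] H))) (x : H) :
    (spectralMeasure U x).real E ≤ ‖x‖ ^ 2 := by
  have h := integral_spectralMeasure U x 1
  rw [contCalc_one, one_apply_eq_self, inner_self_eq_norm_sq_to_K] at h
  have h2 : (spectralMeasure U x).real Set.univ = ‖x‖ ^ 2 := by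
    have h3 : ∫ z, (1 : C(spectrum ℂ (U : H →L[ℂ] H), ℝ)) z ∂(spectralMeasure U x)
        = ‖x‖ ^ 2 := by
      apply Complex.ofReal_injective
      rw [h]
      simp
    rw [← h3]
    simp
  rw [← h2]
  exact measureReal_mono (Set.subset_univ _)

lemma spectralForm_add_right (U : unitary (H →L[ℂ] H))
    {E : Set (spectrum ℂ (U : H →L[ℂ] H))} (hE : MeasurableSet E) (x y z : H) :
    spectralForm U E x (y + z) = spectralForm U E x y + spectralForm U E x z := by
  have hk := sum_spectralForm_eq_zero U (ι := Fin 3) ![1, -1, -1] ![x, x, x] ![y + z, y, z]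
    (fun T => by simp [Fin.sum_univ_three]) hE
  simp only [Fin.sum_univ_three, Matrix.cons_val] at hk
  linear_combination hk

lemma spectralForm_add_left (U : unitary (H →L[ℂ] H))
    {E : Set (spectrum ℂ (U : H →L[ℂ] H))} (hE : MeasurableSet E) (x y z : H) :
    spectralForm U E (x + y) z = spectralForm U E x z + spectralForm U E y z := by
  have hk := sum_spectralForm_eq_zero U (ι := Fin 3) ![1, -1, -1] ![x + y, x, y] ![z, z, z]
    (fun T => by simp [Fin.sum_univ_three]) hE
  simp only [Fin.sum_univ_three, Matrix.cons_val] at hk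
  linear_combination hk

lemma spectralForm_smul_right (U : unitary (H →L[ℂ] H))
    {E : Set (spectrum ℂ (U : H →L[ℂ] H))} (hE : MeasurableSet E) (c : ℂ) (x y : H) :
    spectralForm U E x (c • y) = c * spectralForm U E x y := by
  have hk := sum_spectralForm_eq_zero U (ι := Fin 2) ![1, -c] ![x, x] ![c • y, y]
    (fun T => by simp) hE
  simp only [Fin.sum_univ_two, Matrix.cons_val] at hk
  linear_combination hk

lemma spectralForm_smul_left (U : unitary (H →L[ℂ] H))
    {E : Set (spectrum ℂ (U : H →L[ℂ] H))} (hE : MeasurableSet E) (c : ℂ) (x y : H) :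
    spectralForm U E (c • x) y = starRingEnd ℂ c * spectralForm U E x y := by
  have hk := sum_spectralForm_eq_zero U (ι := Fin 2) ![1, -starRingEnd ℂ c] ![c • x, x] ![y, y]
    (fun T => by simp [mul_comm]) hE
  simp only [Fin.sum_univ_two, Matrix.cons_val] at hk
  linear_combination hk

lemma norm_spectralForm_le (U : unitary (H →L[ℂ] H))
    {E : Set (spectrum ℂ (U : H →L[ℂ] H))} (hE : MeasurableSet E) (x y : H) :
    ‖spectralForm U E x y‖ ≤ 4 * ‖x‖ * ‖y‖ := by
  have unit : ∀ u w : H, ‖u‖ ≤ 1 → ‖w‖ ≤ 1 → ‖spectralForm U E u w‖ ≤ 4 := by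
    intro u w hu hw
    have b : ∀ v : H, ‖v‖ ≤ 2 → ‖((spectralMeasure U v).real E : ℂ)‖ ≤ 4 := by
      intro v hv
      rw [Complex.norm_real, Real.norm_of_nonneg measureReal_nonneg]
      have := spectralMeasure_real_le U E v
      nlinarith [norm_nonneg v]
    have hIw : ‖Complex.I • w‖ ≤ 1 := by rwa [norm_smul, Complex.norm_I, one_mul]
    have b1 := b (u + w) ((norm_add_le _ _).trans (by linarith))
    have b2 := b (u - w) ((norm_sub_le _ _).trans (by linarith))
    have b3 := b (u + Complex.I • w) ((norm_add_le _ _).trans (by linarith))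
    have b4 := b (u - Complex.I • w) ((norm_sub_le _ _).trans (by linarith))
    unfold spectralForm
    rw [norm_mul]
    have h4 : ‖(1 / 4 : ℂ)‖ = 1 / 4 := by simp
    rw [h4]
    have t1 := norm_add_le (((spectralMeasure U (u + w)).real E : ℂ)
      - ((spectralMeasure U (u - w)).real E : ℂ)
      - Complex.I * ((spectralMeasure U (u + Complex.I • w)).real E : ℂ))
      (Complex.I * ((spectralMeasure U (u - Complex.I • w)).real E : ℂ))
    have t2 := norm_sub_le (((spectralMeasure U (u + w)).real E : ℂ)
      - ((spectralMeasure U (u - w)).real E : ℂ))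
      (Complex.I * ((spectralMeasure U (u + Complex.I • w)).real E : ℂ))
    have t3 := norm_sub_le ((spectralMeasure U (u + w)).real E : ℂ)
      ((spectralMeasure U (u - w)).real E : ℂ)
    rw [norm_mul, Complex.norm_I, one_mul] at t1 t2
    linarith
  have hx : (‖x‖ : ℂ) • ((‖x‖ : ℂ)⁻¹ • x) = x := by
    rcases eq_or_ne x 0 with rfl | h
    · simp
    · rw [smul_smul, mul_inv_cancel₀ (by simpa using h), one_smul]
  have hy : (‖y‖ : ℂ) • ((‖y‖ : ℂ)⁻¹ • y) = y := by
    rcases eq_or_ne y 0 with rfl | h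
    · simp
    · rw [smul_smul, mul_inv_cancel₀ (by simpa using h), one_smul]
  have hn : ∀ v : H, ‖(‖v‖ : ℂ)⁻¹ • v‖ ≤ 1 := by
    intro v
    rw [norm_smul, norm_inv, Complex.norm_real, norm_norm]
    exact inv_mul_le_one
  have hu := unit _ _ (hn x) (hn y)
  rw [← hx, ← hy, spectralForm_smul_left U hE, spectralForm_smul_right U hE, hx, hy]
  simp only [norm_mul, Complex.conj_ofReal, Complex.norm_real, norm_norm]
  nlinarith [mul_nonneg (norm_nonneg x) (norm_nonneg y),
    mul_le_mul_of_nonneg_left hu (mul_nonneg (norm_nonneg x) (norm_nonneg y))]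

/-- The spectral theorem: the measures `μ_φ(E)` are the quadratic form of a bounded operator. -/
theorem exists_spectralProjection (U : unitary (H →L[ℂ] H))
    {E : Set (spectrum ℂ (U : H →L[ℂ] H))} (hE : MeasurableSet E) :
    ∃ P : H →L[ℂ] H, ∀ φ : H, ⟪φ, P φ⟫_ℂ = ((spectralMeasure U φ).real E : ℂ) := by
  let B : H →L⋆[ℂ] H →L[ℂ] ℂ := LinearMap.mkContinuous₂
    (LinearMap.mk₂'ₛₗ (starRingEnd ℂ) (RingHom.id ℂ) (spectralForm U E)
      (spectralForm_add_left U hE) (spectralForm_smul_left U hE)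
      (spectralForm_add_right U hE) (spectralForm_smul_right U hE))
    4 (norm_spectralForm_le U hE)
  refine ⟨InnerProductSpace.continuousLinearMapOfBilin B, fun φ => ?_⟩
  rw [← inner_conj_symm, InnerProductSpace.continuousLinearMapOfBilin_apply]
  have h : B φ φ = ((spectralMeasure U φ).real E : ℂ) := spectralForm_self U hE φ
  rw [h, Complex.conj_ofReal]

open Classical in
/-- The spectral projection `1_E(U)` of a Borel set `E ⊆ ℂ`: the unique bounded operator with
`⟨φ, 1_E(U) φ⟩ = μ_φ(E)` for all `φ`, where `μ_φ` is the spectral measure of `U` at `φ`. -/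
def spectralProjection (U : unitary (H →L[ℂ] H)) (E : Set ℂ) : H →L[ℂ] H :=
  if hE : MeasurableSet E then
    (exists_spectralProjection U (measurable_subtype_coe hE)).choose
  else 0

theorem inner_spectralProjection (U : unitary (H →L[ℂ] H)) {E : Set ℂ} (hE : MeasurableSet E)
    (φ : H) :
    ⟪φ, spectralProjection U E φ⟫_ℂ
      = ((spectralMeasure U φ).real (Subtype.val ⁻¹' E) : ℂ) := by
  rw [spectralProjection, dif_pos hE]
  exact (exists_spectralProjection U (measurable_subtype_coe hE)).choose_spec φ

/-- The half-open arc `{e^{iθ} : a ≤ θ < b}` of the unit circle. -/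
def arc (a b : ℝ) : Set ℂ := (fun θ : ℝ => Complex.exp (Complex.I * θ)) '' Set.Ico a b

theorem measurableSet_arc {a b : ℝ} (hb : b ≤ a + 2 * Real.pi) : MeasurableSet (arc a b) := by
  refine measurableSet_Ico.image_of_continuousOn_injOn (by fun_prop) ?_
  intro s hs t ht hst
  obtain ⟨n, hn⟩ := Complex.exp_eq_exp_iff_exists_int.mp hst
  have h1 : s = t + n * (2 * Real.pi) := by
    have h2 : Complex.I * (s : ℂ) = Complex.I * ((t + n * (2 * Real.pi) : ℝ) : ℂ) := by
      rw [hn]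
      push_cast
      ring
    exact_mod_cast mul_left_cancel₀ Complex.I_ne_zero h2
  have hpi := Real.pi_pos
  obtain ⟨hs1, hs2⟩ := hs
  obtain ⟨ht1, ht2⟩ := ht
  have hn0 : n = 0 := by
    have u1 : (n : ℝ) < 1 := by nlinarith
    have u2 : (-1 : ℝ) < n := by nlinarith
    have u3 : n < 1 := by exact_mod_cast u1
    have u4 : -1 < n := by exact_mod_cast u2
    omega
  rw [h1, hn0]
  simp

/-! ### The resolvent and the four quantities -/

/-- `R_U(μ) = (U e^{-iμ} - 1)⁻¹`. For `Im μ ≠ 0` the operator is invertible. -/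
def resolventOp (U : unitary (H →L[ℂ] H)) (μ : ℂ) : H →L[ℂ] H :=
  Ring.inverse (Complex.exp (-(Complex.I * μ)) • (U : H →L[ℂ] H) - 1)

/-- `‖AU^·‖²` for the map `φ ↦ (A U^t φ)_{t ∈ ℤ}` from `H` to `ℓ²(ℤ, H)`, in `[0, ∞]`:
the supremum of `∑_t ‖A U^t φ‖²` over unit vectors `φ`. -/
def smoothNormSq (A : H →L[ℂ] H) (U : unitary (H →L[ℂ] H)) : ℝ≥0∞ :=
  ⨆ (φ : H) (_ : ‖φ‖ = 1), ∑' t : ℤ, ‖A (((U ^ t : unitary (H →L[ℂ] H)) : H →L[ℂ] H) φ)‖ₑ ^ 2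

/-- `‖A R_U(· + iε) φ‖²` in `L²(𝕋, H)`, with `𝕋 = [0, 2π)` and Lebesgue measure. -/
def resolventNormSq (A : H →L[ℂ] H) (U : unitary (H →L[ℂ] H)) (ε : ℝ) (φ : H) : ℝ≥0∞ :=
  ∫⁻ l in Set.Ico 0 (2 * Real.pi), ‖A (resolventOp U ((l : ℂ) + Complex.I * (ε : ℂ)) φ)‖ₑ ^ 2

/-- The supremum over `ε ≠ 0`, `‖φ‖ = 1` of
`‖A R_U(· + iε) φ‖² + ‖A R_U(· - iε) φ‖²` (norms in `L²(𝕋, H)`). -/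
def resolventSup (A : H →L[ℂ] H) (U : unitary (H →L[ℂ] H)) : ℝ≥0∞ :=
  ⨆ (ε : ℝ) (_ : ε ≠ 0) (φ : H) (_ : ‖φ‖ = 1),
    (resolventNormSq A U ε φ + resolventNormSq A U (-ε) φ)

/-- The supremum over `Im μ ≠ 0` of `‖A (R_U(μ) - R_U(μ̄)) A*‖`. -/
def jumpSup (A : H →L[ℂ] H) (U : unitary (H →L[ℂ] H)) : ℝ≥0∞ :=
  ⨆ (μ : ℂ) (_ : μ.im ≠ 0),
    ‖A * (resolventOp U μ - resolventOp U (starRingEnd ℂ μ)) * ContinuousLinearMap.adjoint A‖ₑ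

/-- The supremum over non-empty half-open arcs `[a, b)` of `‖A 1_{[a,b)}(U)‖² / |b - a|`. -/
def arcSup (A : H →L[ℂ] H) (U : unitary (H →L[ℂ] H)) : ℝ≥0∞ :=
  ⨆ (a : ℝ) (b : ℝ) (_ : a < b) (_ : b ≤ a + 2 * Real.pi),
    ‖A * spectralProjection U (arc a b)‖ₑ ^ 2 / ENNReal.ofReal (b - a)

end

end KatoUnitary

namespace KatoUnitary

/-! All four quantities are read off from G_c = (1 - cU)⁻¹ with ‖c‖ < 1, called `geom`. Below the
real axis the resolvent is -G_c, a power series in U. Above the axis it is a power series in U⁻¹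
starting at U⁻¹. The jump between conjugate points is the Poisson kernel of U, (1 - ‖c‖²) G_c G_c*
(`resolventOp_sub_conj`).

Orbit and resolvents: on the lines Im μ = ±ε the Fourier coefficients of A R_U φ are, up to sign,
e^{-ε|t|} A U^t φ, with t < 0 on the upper line and t ≥ 0 on the lower one. Parseval turns the two
L² norms into 2π times one damped square sum, and the damping disappears as ε → 0
(`resolventSup_eq`).

Orbit and jump: by the C*-identity the jump sandwiched by A and A* has norm (1 - ‖c‖²)‖A G_c‖².
Cauchy-Schwarz on the geometric series bounds this by the orbit sum. Conversely, Parseval for the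
jump applied to φ gives the damped orbit sum; there ‖A G_c‖ is bounded by the supremum, while ‖G_c*
φ‖² is integrated exactly by a second use of Parseval.

Jump and arcs: let μ_ψ be the spectral measure at A*ψ. The jump norm is the supremum over unit ψ of
∫ P_c dμ_ψ, with P_c the scalar Poisson kernel, and ‖A 1_E(U)‖² is the supremum of μ_ψ(E). What
remains is a fact about measures on the circle: Poisson integrals at most C are equivalent to arc
masses at most C/(2π) times the arc length (`measureReal_arc_le`, `lintegral_poisson_le`). -/

/-! ### Parseval's identity on the circle. -/

lemma integral_exp_int_mul (n : ℤ) :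
    ∫ l in (0 : ℝ)..(2 * Real.pi), Complex.exp (Complex.I * n * l)
      = if n = 0 then (2 * Real.pi : ℂ) else 0 := by
  split_ifs with h
  · simp [h]
  · have hc : Complex.I * (n : ℂ) ≠ 0 := mul_ne_zero Complex.I_ne_zero (by exact_mod_cast h)
    rw [integral_exp_mul_complex hc]
    have : Complex.I * (n : ℂ) * ((2 * Real.pi : ℝ) : ℂ) = n * (2 * Real.pi * Complex.I) := by
      push_cast; ring
    rw [this, Complex.exp_int_mul_two_pi_mul_I]
    simp

/-- Parseval's identity for absolutely convergent trigonometric series with vector coefficients. -/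
theorem lintegral_enorm_sq_eq_of_hasSum {H : Type*} [NormedAddCommGroup H] [InnerProductSpace ℂ H]
    [CompleteSpace H]
    {ι : Type*} [Countable ι] {k : ι → ℤ} (hk : Function.Injective k) {c : ι → H}
    (hc : Summable fun n => ‖c n‖) {F : ℝ → H}
    (hF : ∀ l : ℝ, HasSum (fun n => Complex.exp (Complex.I * k n * l) • c n) (F l)) :
    ∫⁻ l in Set.Ico 0 (2 * Real.pi), ‖F l‖ₑ ^ 2
      = ENNReal.ofReal (2 * Real.pi) * ∑' n, ‖c n‖ₑ ^ 2 := by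
  classical
  have hnorm : ∀ n (l : ℝ), ‖Complex.exp (Complex.I * k n * l) • c n‖ = ‖c n‖ := by
    intro n l
    have : Complex.I * k n * l = ((k n * l : ℝ) : ℂ) * Complex.I := by push_cast; ring
    rw [norm_smul, this, Complex.norm_exp_ofReal_mul_I, one_mul]
  have hcont : Continuous F := by
    have : F = fun l : ℝ => ∑' n, Complex.exp (Complex.I * k n * l) • c n :=
      funext fun l => (hF l).tsum_eq.symm
    rw [this]
    exact continuous_tsum (fun n => by fun_prop) hc fun n l => (hnorm n l).le
  set B := ∑' n, ‖c n‖
  have hFB : ∀ l, ‖F l‖ ≤ B := fun l => by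
    rw [← (hF l).tsum_eq]
    exact tsum_of_norm_bounded hc.hasSum fun n => (hnorm n l).le
  have hpi : (0 : ℝ) ≤ 2 * Real.pi := by positivity
  -- Pairing with F and integrating termwise leaves only the frequency k m, because k is injective.
  have coef : ∀ m, ∫ l in (0 : ℝ)..(2 * Real.pi),
      ⟪Complex.exp (Complex.I * k m * l) • c m, F l⟫_ℂ = (2 * Real.pi : ℂ) * ⟪c m, c m⟫_ℂ := by
    intro m
    have h1 : HasSum (fun n => ∫ l in (0 : ℝ)..(2 * Real.pi),
        ⟪Complex.exp (Complex.I * k m * l) • c m, Complex.exp (Complex.I * k n * l) • c n⟫_ℂ)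
        (∫ l in (0 : ℝ)..(2 * Real.pi), ⟪Complex.exp (Complex.I * k m * l) • c m, F l⟫_ℂ) := by
      refine intervalIntegral.hasSum_integral_of_dominated_convergence
        (fun n _ => ‖c m‖ * ‖c n‖) (fun n => ?_) (fun n => ?_) ?_ ?_ ?_
      · exact Continuous.aestronglyMeasurable (by fun_prop)
      · refine Filter.Eventually.of_forall fun l _ => (norm_inner_le_norm _ _).trans ?_
        rw [hnorm, hnorm]
      · exact Filter.Eventually.of_forall fun l _ => hc.mul_left _
      · simp
      · exact Filter.Eventually.of_forall fun l _ => (hF l).mapL (innerSL ℂ _)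
    have h2 : ∀ n, ∫ l in (0 : ℝ)..(2 * Real.pi),
        ⟪Complex.exp (Complex.I * k m * l) • c m, Complex.exp (Complex.I * k n * l) • c n⟫_ℂ
        = if n = m then (2 * Real.pi : ℂ) * ⟪c m, c m⟫_ℂ else 0 := by
      intro n
      have h3 : ∀ l : ℝ, ⟪Complex.exp (Complex.I * k m * l) • c m,
          Complex.exp (Complex.I * k n * l) • c n⟫_ℂ
          = Complex.exp (Complex.I * ((k n - k m : ℤ) : ℂ) * l) * ⟪c m, c n⟫_ℂ := by
        intro l
        rw [inner_smul_left, inner_smul_right, ← mul_assoc, ← Complex.exp_conj, ← Complex.exp_add]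
        congr 2
        simp
        ring
      simp_rw [h3]
      rw [intervalIntegral.integral_mul_const, integral_exp_int_mul]
      by_cases hnm : n = m
      · simp [hnm]
      · rw [if_neg hnm, if_neg (sub_ne_zero.mpr fun h => hnm (hk h)), zero_mul]
    simp_rw [h2] at h1
    exact h1.unique (hasSum_ite_eq m _)
  -- Expanding the left copy of F in ⟪F, F⟫ turns each term into one of the integrals in `coef`.
  have total : HasSum (fun m => (2 * Real.pi : ℂ) * ⟪c m, c m⟫_ℂ)
      (∫ l in (0 : ℝ)..(2 * Real.pi), ⟪F l, F l⟫_ℂ) := by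
    simp_rw [← coef]
    refine intervalIntegral.hasSum_integral_of_dominated_convergence
      (fun n _ => ‖c n‖ * B) (fun n => ?_) (fun n => ?_) ?_ ?_ ?_
    · exact Continuous.aestronglyMeasurable (by fun_prop)
    · refine Filter.Eventually.of_forall fun l _ => (norm_inner_le_norm _ _).trans ?_
      rw [hnorm]
      exact mul_le_mul_of_nonneg_left (hFB l) (norm_nonneg _)
    · exact Filter.Eventually.of_forall fun l _ => hc.mul_right _
    · simp
    · refine Filter.Eventually.of_forall fun l _ => ?_
      have := (hF l).mapL (innerSL ℂ (F l))
      have h5 := this.map (starRingEnd ℂ) Complex.continuous_conj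
      simpa [Function.comp_def, mul_comm] using h5
  have hself : ∀ x : H, ⟪x, x⟫_ℂ = ((‖x‖ ^ 2 : ℝ) : ℂ) := fun x => by
    rw [inner_self_eq_norm_sq_to_K]; simp
  have total' : HasSum (fun m => (2 * Real.pi) * ‖c m‖ ^ 2)
      (∫ l in (0 : ℝ)..(2 * Real.pi), ‖F l‖ ^ 2) := by
    simp_rw [hself, intervalIntegral.integral_ofReal] at total
    exact_mod_cast total
  have hsq : ∀ x : H, ‖x‖ₑ ^ 2 = ENNReal.ofReal (‖x‖ ^ 2) := fun x => by
    rw [ENNReal.ofReal_pow (norm_nonneg _), ofReal_norm]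
  rw [intervalIntegral.integral_of_le hpi, ← integral_Ico_eq_integral_Ioc] at total'
  simp_rw [hsq]
  rw [← ofReal_integral_eq_lintegral_ofReal, ← total'.tsum_eq,
    ENNReal.ofReal_tsum_of_nonneg (fun n => by positivity) total'.summable, ← ENNReal.tsum_mul_left]
  · exact tsum_congr fun n => ENNReal.ofReal_mul hpi
  · exact ((hcont.norm.pow 2).integrableOn_Icc).mono_set Set.Ico_subset_Icc_self
  · exact Filter.Eventually.of_forall fun l => by positivity

/-! ### The resolvent as a geometric series and its jump. -/

variable {H : Type*} [NormedAddCommGroup H] [InnerProductSpace ℂ H] [CompleteSpace H]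

/-- The inverse of `1 - c U`, for `‖c‖ < 1` the sum of the geometric series of `c U`. -/
noncomputable def geom (U : unitary (H →L[ℂ] H)) (c : ℂ) : H →L[ℂ] H :=
  Ring.inverse (1 - c • (U : H →L[ℂ] H))

lemma norm_unitary_apply (U : unitary (H →L[ℂ] H)) (x : H) : ‖(U : H →L[ℂ] H) x‖ = ‖x‖ :=
  Unitary.norm_map U x

lemma norm_smul_unitary_lt_one (U : unitary (H →L[ℂ] H)) {c : ℂ} (hc : ‖c‖ < 1) :
    ‖c • (U : H →L[ℂ] H)‖ < 1 := by
  refine lt_of_le_of_lt (ContinuousLinearMap.opNorm_le_bound _ (norm_nonneg c) fun x => ?_) hc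
  rw [smul_apply, norm_smul, norm_unitary_apply]

lemma isUnit_one_sub_smul (U : unitary (H →L[ℂ] H)) {c : ℂ} (hc : ‖c‖ < 1) :
    IsUnit (1 - c • (U : H →L[ℂ] H)) :=
  isUnit_one_sub_of_norm_lt_one (norm_smul_unitary_lt_one U hc)

lemma geom_mul (U : unitary (H →L[ℂ] H)) {c : ℂ} (hc : ‖c‖ < 1) :
    geom U c * (1 - c • (U : H →L[ℂ] H)) = 1 :=
  Ring.inverse_mul_cancel _ (isUnit_one_sub_smul U hc)

lemma mul_geom (U : unitary (H →L[ℂ] H)) {c : ℂ} (hc : ‖c‖ < 1) :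
    (1 - c • (U : H →L[ℂ] H)) * geom U c = 1 :=
  Ring.mul_inverse_cancel _ (isUnit_one_sub_smul U hc)

lemma star_geom (U : unitary (H →L[ℂ] H)) {c : ℂ} (hc : ‖c‖ < 1) :
    star (geom U c) = geom U⁻¹ (starRingEnd ℂ c) := by
  have h : star (1 - c • (U : H →L[ℂ] H))
      = 1 - starRingEnd ℂ c • ((U⁻¹ : unitary (H →L[ℂ] H)) : H →L[ℂ] H) := by
    rw [star_sub, star_one, star_smul]
    rfl
  have h1 := congrArg star (geom_mul U hc)
  rw [star_mul, star_one, h] at h1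
  exact (left_inv_eq_right_inv (geom_mul U⁻¹ (by simpa using hc)) h1).symm

lemma hasSum_geom_apply (U : unitary (H →L[ℂ] H)) {c : ℂ} (hc : ‖c‖ < 1) (φ : H) :
    HasSum (fun n : ℕ => c ^ n • ((U ^ n : unitary (H →L[ℂ] H)) : H →L[ℂ] H) φ)
      (geom U c φ) := by
  have hn := norm_smul_unitary_lt_one U hc
  have h1 : HasSum (fun n : ℕ => (c • (U : H →L[ℂ] H)) ^ n) (geom U c) := by
    have h2 := (summable_geometric_of_norm_lt_one hn).hasSum
    rwa [left_inv_eq_right_inv (geom_series_mul_neg _ hn) (mul_geom U hc)] at h2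
  have h3 := h1.mapL (ContinuousLinearMap.apply ℂ H φ)
  refine h3.congr_fun fun n => ?_
  simp [smul_pow]

/-- The case Im μ < 0, since ‖e^{-iμ}‖ = e^{Im μ}: the resolvent expands in nonnegative powers of U.
-/
lemma resolventOp_eq_neg_geom (U : unitary (H →L[ℂ] H)) {μ c : ℂ} (hc : ‖c‖ < 1)
    (h : Complex.exp (-(Complex.I * μ)) = c) : resolventOp U μ = -geom U c := by
  rw [resolventOp, h]
  have h1 : (c • (U : H →L[ℂ] H) - 1) * (-geom U c) = 1 := by
    rw [mul_neg, ← neg_mul, neg_sub, mul_geom U hc]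
  have h2 : (-geom U c) * (c • (U : H →L[ℂ] H) - 1) = 1 := by
    rw [neg_mul, ← mul_neg, neg_sub, geom_mul U hc]
  exact Ring.inverse_unit ⟨_, _, h1, h2⟩

/-- The case Im μ > 0. Factoring c⁻¹U - 1 = c⁻¹U(1 - cU⁻¹) leaves a convergent geometric series in
U⁻¹; the extra factor U⁻¹ makes the expansion start at exponent -1. -/
lemma resolventOp_eq_smul_geom_inv (U : unitary (H →L[ℂ] H)) {μ c : ℂ} (hc : ‖c‖ < 1)
    (h0 : c ≠ 0) (h : Complex.exp (-(Complex.I * μ)) = c⁻¹) :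
    resolventOp U μ = c • (((U⁻¹ : unitary (H →L[ℂ] H)) : H →L[ℂ] H) * geom U⁻¹ c) := by
  rw [resolventOp, h]
  set V : H →L[ℂ] H := ((U⁻¹ : unitary (H →L[ℂ] H)) : H →L[ℂ] H) with hV
  have hUV : (U : H →L[ℂ] H) * V = 1 := Unitary.coe_mul_star_self U
  have hVU : V * (U : H →L[ℂ] H) = 1 := Unitary.coe_star_mul_self U
  have key : c⁻¹ • (U : H →L[ℂ] H) - 1 = c⁻¹ • ((U : H →L[ℂ] H) * (1 - c • V)) := by
    rw [mul_sub, mul_one, mul_smul_comm, hUV, smul_sub, smul_smul, inv_mul_cancel₀ h0, one_smul]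
  have key' : c⁻¹ • (U : H →L[ℂ] H) - 1 = c⁻¹ • ((1 - c • V) * (U : H →L[ℂ] H)) := by
    rw [sub_mul, one_mul, smul_mul_assoc, hVU, smul_sub, smul_smul, inv_mul_cancel₀ h0, one_smul]
  have comm : V * geom U⁻¹ c = geom U⁻¹ c * V := by
    have : V * (1 - c • V) = (1 - c • V) * V := by simp [mul_sub, sub_mul]
    calc V * geom U⁻¹ c = geom U⁻¹ c * (1 - c • V) * V * geom U⁻¹ c := by
          rw [geom_mul U⁻¹ hc, one_mul]
      _ = geom U⁻¹ c * (V * (1 - c • V)) * geom U⁻¹ c := by rw [this]; noncomm_ring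
      _ = geom U⁻¹ c * V * ((1 - c • V) * geom U⁻¹ c) := by noncomm_ring
      _ = geom U⁻¹ c * V := by rw [mul_geom U⁻¹ hc, mul_one]
  have h1 : (c⁻¹ • (U : H →L[ℂ] H) - 1) * (c • (V * geom U⁻¹ c)) = 1 := by
    rw [key, smul_mul_smul_comm, inv_mul_cancel₀ h0, one_smul, comm, mul_assoc,
      ← mul_assoc (1 - c • V), mul_geom U⁻¹ hc, one_mul, hUV]
  have h2 : (c • (V * geom U⁻¹ c)) * (c⁻¹ • (U : H →L[ℂ] H) - 1) = 1 := by
    rw [key', smul_mul_smul_comm, mul_inv_cancel₀ h0, one_smul, mul_assoc,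
      ← mul_assoc (geom U⁻¹ c), geom_mul U⁻¹ hc, one_mul, hVU]
  exact Ring.inverse_unit ⟨_, _, h1, h2⟩

/-- Both outer factors are invertible, so T can be identified by multiplying out. This recognises
the same operator twice: as the jump of the resolvent and as the Poisson kernel in the functional
calculus. -/
lemma eq_smul_geom_mul_star (U : unitary (H →L[ℂ] H)) {c : ℂ} (hc : ‖c‖ < 1) {T : H →L[ℂ] H}
    (hT : (1 - c • (U : H →L[ℂ] H)) * T * star (1 - c • (U : H →L[ℂ] H))
      = ((1 - ‖c‖ ^ 2 : ℝ) : ℂ) • 1) :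
    T = ((1 - ‖c‖ ^ 2 : ℝ) : ℂ) • (geom U c * star (geom U c)) := by
  have h1 := congrArg star (geom_mul U hc)
  rw [star_mul, star_one] at h1
  calc T = geom U c * ((1 - c • (U : H →L[ℂ] H)) * T * star (1 - c • (U : H →L[ℂ] H)))
          * star (geom U c) := by
        rw [mul_assoc _ _ (star (1 - _)), ← mul_assoc, geom_mul U hc, one_mul, mul_assoc, h1,
          mul_one]
    _ = _ := by rw [hT, mul_smul_comm, mul_one, smul_mul_assoc]

/-- Conjugation of μ becomes reflection of e^{-iμ} in the unit circle. -/
lemma exp_neg_I_mul_conj (μ : ℂ) : Complex.exp (-(Complex.I * μ))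
    = (starRingEnd ℂ (Complex.exp (-(Complex.I * starRingEnd ℂ μ))))⁻¹ := by
  rw [← Complex.exp_conj, ← Complex.exp_neg]
  simp

/-- The jump of the resolvent across the real axis is the Poisson kernel of `U`. -/
theorem resolventOp_sub_conj (U : unitary (H →L[ℂ] H)) {μ c : ℂ} (hc : ‖c‖ < 1)
    (h : Complex.exp (-(Complex.I * starRingEnd ℂ μ)) = c) :
    resolventOp U μ - resolventOp U (starRingEnd ℂ μ)
      = ((1 - ‖c‖ ^ 2 : ℝ) : ℂ) • (geom U c * star (geom U c)) := by
  have h0 : starRingEnd ℂ c ≠ 0 := by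
    rw [← h]; simp
  have hc' : ‖starRingEnd ℂ c‖ < 1 := by simpa using hc
  apply eq_smul_geom_mul_star U hc
  rw [resolventOp_eq_neg_geom U hc h,
    resolventOp_eq_smul_geom_inv U hc' h0 (by rw [exp_neg_I_mul_conj, h])]
  set V : H →L[ℂ] H := ((U⁻¹ : unitary (H →L[ℂ] H)) : H →L[ℂ] H) with hV
  have hUV : (U : H →L[ℂ] H) * V = 1 := Unitary.coe_mul_star_self U
  have hs : star (1 - c • (U : H →L[ℂ] H)) = 1 - starRingEnd ℂ c • V := by
    rw [star_sub, star_one, star_smul]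
    rfl
  rw [hs, sub_neg_eq_add, mul_add, add_mul, mul_geom U hc, one_mul, mul_smul_comm, smul_mul_assoc,
    mul_assoc, mul_assoc V, geom_mul U⁻¹ hc', mul_one, sub_mul, one_mul, smul_mul_assoc, hUV]
  have : starRingEnd ℂ c * c = ((‖c‖ ^ 2 : ℝ) : ℂ) := by
    rw [mul_comm, Complex.mul_conj, Complex.normSq_eq_norm_sq]
  rw [smul_sub, smul_smul, this]
  push_cast
  rw [sub_smul, one_smul]
  abel

/-- The jump is a nonnegative multiple of G G*, so the C*-identity for A G collapses the norm to a
square. -/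
lemma enorm_mul_resolventOp_sub_mul_adjoint (A : H →L[ℂ] H) (U : unitary (H →L[ℂ] H)) {μ c : ℂ}
    (hc : ‖c‖ < 1) (h : Complex.exp (-(Complex.I * starRingEnd ℂ μ)) = c) :
    ‖A * (resolventOp U μ - resolventOp U (starRingEnd ℂ μ)) * ContinuousLinearMap.adjoint A‖ₑ
      = ENNReal.ofReal ((1 - ‖c‖ ^ 2) * ‖A * geom U c‖ ^ 2) := by
  rw [resolventOp_sub_conj U hc h, ← ContinuousLinearMap.star_eq_adjoint, ← ofReal_norm]
  congr 1
  have h1 : A * (((1 - ‖c‖ ^ 2 : ℝ) : ℂ) • (geom U c * star (geom U c))) * star A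
      = ((1 - ‖c‖ ^ 2 : ℝ) : ℂ) • ((A * geom U c) * star (A * geom U c)) := by
    rw [star_mul, mul_smul_comm, smul_mul_assoc]
    noncomm_ring
  rw [h1, norm_smul, CStarRing.norm_self_mul_star, Complex.norm_real, Real.norm_of_nonneg]
  · ring
  · nlinarith [norm_nonneg c]

/-- The jump changes sign under μ ↦ μ̄, so only Im μ > 0 matters; there c = e^{-iμ̄} runs through
the punctured unit disc. -/
theorem jumpSup_le_iff (A : H →L[ℂ] H) (U : unitary (H →L[ℂ] H)) (C : ℝ≥0∞) :
    jumpSup A U ≤ C ↔ ∀ c : ℂ, c ≠ 0 → ‖c‖ < 1 →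
      ENNReal.ofReal ((1 - ‖c‖ ^ 2) * ‖A * geom U c‖ ^ 2) ≤ C := by
  have hnorm : ∀ μ : ℂ, ‖Complex.exp (-(Complex.I * starRingEnd ℂ μ))‖ = Real.exp (-μ.im) := by
    intro μ
    rw [Complex.norm_exp]
    simp
  have hpos : ∀ μ : ℂ, 0 < μ.im → (∀ c : ℂ, c ≠ 0 → ‖c‖ < 1 →
      ENNReal.ofReal ((1 - ‖c‖ ^ 2) * ‖A * geom U c‖ ^ 2) ≤ C) →
      ‖A * (resolventOp U μ - resolventOp U (starRingEnd ℂ μ))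
        * ContinuousLinearMap.adjoint A‖ₑ ≤ C := by
    intro μ hμ h
    have hc : ‖Complex.exp (-(Complex.I * starRingEnd ℂ μ))‖ < 1 := by
      rw [hnorm]; simpa using hμ
    rw [enorm_mul_resolventOp_sub_mul_adjoint A U hc rfl]
    exact h _ (Complex.exp_ne_zero _) hc
  rw [jumpSup, iSup₂_le_iff]
  constructor
  · intro h c h0 hc
    -- The point μ is the conjugate of i log c, which gives e^{-iμ̄} = e^{log c}.
    have hexp : Complex.exp (-(Complex.I * starRingEnd ℂ (starRingEnd ℂ (Complex.I * Complex.log c))))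
        = c := by
      rw [Complex.conj_conj, ← mul_assoc, Complex.I_mul_I]
      simpa using Complex.exp_log h0
    rw [← enorm_mul_resolventOp_sub_mul_adjoint A U hc hexp]
    apply h
    have := Real.log_neg (norm_pos_iff.mpr h0) hc
    simpa [Complex.log_re] using this.ne
  · intro h μ hμ
    rcases lt_or_gt_of_ne hμ with hneg | hp
    · have := hpos (starRingEnd ℂ μ) (by simpa using hneg) h
      rw [Complex.conj_conj] at this
      rw [← neg_sub, mul_neg, neg_mul, enorm_neg]
      exact this
    · exact hpos μ hp h

/-! ### Damped orbits as Fourier coefficients of the resolvent. -/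

/-- The orbit `t ↦ A U^t φ` damped by `e^{-ε|t|}`. -/
noncomputable def dampedOrbit (A : H →L[ℂ] H) (U : unitary (H →L[ℂ] H)) (ε : ℝ) (φ : H) (t : ℤ) :
    H :=
  ((Real.exp (-(ε * |(t : ℝ)|)) : ℝ) : ℂ) • A (((U ^ t : unitary (H →L[ℂ] H)) : H →L[ℂ] H) φ)

lemma exp_neg_mul_natCast (ε : ℝ) (n : ℕ) :
    Real.exp (-(ε * |((n : ℤ) : ℝ)|)) = Real.exp (-ε) ^ n := by
  rw [← Real.exp_nat_mul]
  congr 1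
  simp
  ring

lemma exp_neg_mul_negSucc (ε : ℝ) (n : ℕ) :
    Real.exp (-(ε * |((-(n + 1 : ℤ) : ℤ) : ℝ)|)) = Real.exp (-ε) ^ (n + 1) := by
  rw [Int.cast_neg, abs_neg, ← exp_neg_mul_natCast]
  push_cast
  rfl

lemma norm_exp_mul_I_mul (ε : ℝ) (s l : ℝ) :
    ‖Complex.exp (Complex.I * (s * l)) * (Real.exp (-ε) : ℂ)‖ = Real.exp (-ε) := by
  have : Complex.I * ((s : ℂ) * l) = ((s * l : ℝ) : ℂ) * Complex.I := by push_cast; ring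
  rw [norm_mul, this, Complex.norm_exp_ofReal_mul_I, one_mul, Complex.norm_real,
    Real.norm_of_nonneg (Real.exp_pos _).le]

lemma hasSum_resolventOp_lower (A : H →L[ℂ] H) (U : unitary (H →L[ℂ] H)) {ε : ℝ} (hε : 0 < ε)
    (φ : H) (l : ℝ) :
    HasSum (fun n : ℕ => Complex.exp (Complex.I * ((-(n : ℤ) : ℤ) : ℂ) * l)
      • dampedOrbit A U ε φ n)
      (-(A (resolventOp U (l + Complex.I * ((-ε : ℝ) : ℂ)) φ))) := by
  set c : ℂ := Complex.exp (Complex.I * (((-1 : ℝ) : ℂ) * l)) * (Real.exp (-ε) : ℂ) with hcdef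
  have hc : ‖c‖ < 1 := by rw [norm_exp_mul_I_mul]; simpa using hε
  have he : Complex.exp (-(Complex.I * (l + Complex.I * ((-ε : ℝ) : ℂ)))) = c := by
    rw [hcdef, Complex.ofReal_exp, ← Complex.exp_add]
    congr 1
    push_cast
    linear_combination ε * Complex.I_mul_I
  rw [resolventOp_eq_neg_geom U hc he, neg_apply, map_neg, neg_neg]
  refine ((hasSum_geom_apply U hc φ).mapL A).congr_fun fun n => ?_
  rw [dampedOrbit, map_smul, smul_smul, zpow_natCast, exp_neg_mul_natCast, hcdef, mul_pow,
    ← Complex.exp_nat_mul]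
  congr 2
  · congr 1
    push_cast
    ring
  · push_cast
    rfl

lemma hasSum_resolventOp_upper (A : H →L[ℂ] H) (U : unitary (H →L[ℂ] H)) {ε : ℝ} (hε : 0 < ε)
    (φ : H) (l : ℝ) :
    HasSum (fun n : ℕ => Complex.exp (Complex.I * ((-(-(n + 1 : ℤ)) : ℤ) : ℂ) * l)
      • dampedOrbit A U ε φ (-(n + 1 : ℤ)))
      (A (resolventOp U (l + Complex.I * (ε : ℂ)) φ)) := by
  set c : ℂ := Complex.exp (Complex.I * (((1 : ℝ) : ℂ) * l)) * (Real.exp (-ε) : ℂ) with hcdef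
  have hc : ‖c‖ < 1 := by rw [norm_exp_mul_I_mul]; simpa using hε
  have h0 : c ≠ 0 := mul_ne_zero (Complex.exp_ne_zero _) (by exact_mod_cast (Real.exp_pos _).ne')
  have he : Complex.exp (-(Complex.I * (l + Complex.I * (ε : ℂ)))) = c⁻¹ := by
    rw [hcdef, Complex.ofReal_exp, ← Complex.exp_add, ← Complex.exp_neg]
    congr 1
    push_cast
    linear_combination (-ε) * Complex.I_mul_I
  rw [resolventOp_eq_smul_geom_inv U hc h0 he, smul_apply, map_smul, mul_apply_eq_comp]
  refine (((hasSum_geom_apply U⁻¹ hc φ).mapL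
    (A.comp ((U⁻¹ : unitary (H →L[ℂ] H)) : H →L[ℂ] H))).const_smul c).congr_fun fun n => ?_
  have hz : U ^ (-(n + 1 : ℤ)) = U⁻¹ * U⁻¹ ^ n := by
    rw [← pow_succ', inv_pow, zpow_neg]
    norm_cast
  have hA : A ((((U⁻¹ * U⁻¹ ^ n : unitary (H →L[ℂ] H))) : H →L[ℂ] H) φ)
      = (A.comp ((U⁻¹ : unitary (H →L[ℂ] H)) : H →L[ℂ] H))
        (((U⁻¹ ^ n : unitary (H →L[ℂ] H)) : H →L[ℂ] H) φ) := rfl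
  rw [dampedOrbit, map_smul, smul_smul, smul_smul, hz, hA, exp_neg_mul_negSucc,
    ← pow_succ' c, hcdef, mul_pow, ← Complex.exp_nat_mul]
  congr 2
  · congr 1
    push_cast
    ring
  · push_cast
    rfl

lemma norm_dampedOrbit_le (A : H →L[ℂ] H) (U : unitary (H →L[ℂ] H)) (ε : ℝ) (φ : H) (t : ℤ) :
    ‖dampedOrbit A U ε φ t‖ ≤ Real.exp (-(ε * |(t : ℝ)|)) * (‖A‖ * ‖φ‖) := by
  rw [dampedOrbit, norm_smul, Complex.norm_real, Real.norm_of_nonneg (Real.exp_pos _).le]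
  gcongr
  refine (A.le_opNorm _).trans ?_
  rw [norm_unitary_apply]

lemma summable_norm_dampedOrbit_nat (A : H →L[ℂ] H) (U : unitary (H →L[ℂ] H)) {ε : ℝ} (hε : 0 < ε)
    (φ : H) : Summable fun n : ℕ => ‖dampedOrbit A U ε φ n‖ := by
  refine .of_nonneg_of_le (fun n => norm_nonneg _) (fun n => norm_dampedOrbit_le A U ε φ n) ?_
  simp_rw [exp_neg_mul_natCast]
  exact (summable_geometric_of_lt_one (Real.exp_pos _).le (by simpa using hε)).mul_right _

lemma summable_norm_dampedOrbit_neg (A : H →L[ℂ] H) (U : unitary (H →L[ℂ] H)) {ε : ℝ} (hε : 0 < ε)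
    (φ : H) : Summable fun n : ℕ => ‖dampedOrbit A U ε φ (-(n + 1 : ℤ))‖ := by
  refine .of_nonneg_of_le (fun n => norm_nonneg _) (fun n => norm_dampedOrbit_le A U ε φ _) ?_
  simp_rw [exp_neg_mul_negSucc]
  exact ((summable_nat_add_iff 1).mpr
    (summable_geometric_of_lt_one (Real.exp_pos _).le (by simpa using hε))).mul_right _

/-- The two lines carry complementary halves of the orbit: t < 0 on Im μ = ε and t ≥ 0 on Im μ = -ε.
Parseval on each line and addition give the sum over all of ℤ. -/
theorem resolventNormSq_add (A : H →L[ℂ] H) (U : unitary (H →L[ℂ] H)) {ε : ℝ} (hε : 0 < ε)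
    (φ : H) :
    resolventNormSq A U ε φ + resolventNormSq A U (-ε) φ
      = ENNReal.ofReal (2 * Real.pi) * ∑' t : ℤ, ‖dampedOrbit A U ε φ t‖ₑ ^ 2 := by
  have h1 := lintegral_enorm_sq_eq_of_hasSum (k := fun n : ℕ => -(-(n + 1 : ℤ)))
    (fun m n h => by simpa using h) (summable_norm_dampedOrbit_neg A U hε φ)
    (fun l => hasSum_resolventOp_upper A U hε φ l)
  have h2 := lintegral_enorm_sq_eq_of_hasSum (k := fun n : ℕ => -(n : ℤ))
    (fun m n h => by simpa using h) (summable_norm_dampedOrbit_nat A U hε φ)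
    (fun l => hasSum_resolventOp_lower A U hε φ l)
  simp_rw [enorm_neg] at h2
  have h3 : ∑' t : ℤ, ‖dampedOrbit A U ε φ t‖ₑ ^ 2 = _ :=
    (HasSum.of_nat_of_neg_add_one (f := fun t : ℤ => ‖dampedOrbit A U ε φ t‖ₑ ^ 2)
      ENNReal.summable.hasSum ENNReal.summable.hasSum).tsum_eq
  rw [resolventNormSq, resolventNormSq, h1, h2, h3, ← mul_add, add_comm]

lemma enorm_dampedOrbit_le (A : H →L[ℂ] H) (U : unitary (H →L[ℂ] H)) {ε : ℝ} (hε : 0 ≤ ε)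
    (φ : H) (t : ℤ) : ‖dampedOrbit A U ε φ t‖ₑ
      ≤ ‖A (((U ^ t : unitary (H →L[ℂ] H)) : H →L[ℂ] H) φ)‖ₑ := by
  rw [enorm_le_iff_norm_le, dampedOrbit, norm_smul, Complex.norm_real,
    Real.norm_of_nonneg (Real.exp_pos _).le]
  refine mul_le_of_le_one_left (norm_nonneg _) (Real.exp_le_one_iff.mpr ?_)
  have := mul_nonneg hε (abs_nonneg (t : ℝ))
  linarith

/-- Each finite partial sum is continuous in ε, so the damping can be removed there by ε → 0+ before
taking the supremum over finite sets. -/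
lemma tsum_enorm_sq_le_of_dampedOrbit (A : H →L[ℂ] H) (U : unitary (H →L[ℂ] H)) (φ : H)
    {C : ℝ≥0∞} (h : ∀ ε : ℝ, 0 < ε → ∑' t : ℤ, ‖dampedOrbit A U ε φ t‖ₑ ^ 2 ≤ C) :
    ∑' t : ℤ, ‖A (((U ^ t : unitary (H →L[ℂ] H)) : H →L[ℂ] H) φ)‖ₑ ^ 2 ≤ C := by
  rw [ENNReal.tsum_eq_iSup_sum]
  refine iSup_le fun s => ?_
  have ht : Filter.Tendsto (fun ε : ℝ => ∑ t ∈ s, ‖dampedOrbit A U ε φ t‖ₑ ^ 2)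
      (nhdsWithin 0 (Set.Ioi 0))
      (nhds (∑ t ∈ s, ‖A (((U ^ t : unitary (H →L[ℂ] H)) : H →L[ℂ] H) φ)‖ₑ ^ 2)) := by
    refine tendsto_finsetSum _ fun t _ => ?_
    have hcont : Continuous fun ε : ℝ => ‖dampedOrbit A U ε φ t‖ₑ ^ 2 := by
      refine (ENNReal.continuous_pow 2).comp (Continuous.enorm ?_)
      unfold dampedOrbit
      fun_prop
    have h0 := hcont.tendsto 0
    rw [show dampedOrbit A U 0 φ t = A (((U ^ t : unitary (H →L[ℂ] H)) : H →L[ℂ] H) φ) by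
      simp [dampedOrbit]] at h0
    exact h0.mono_left nhdsWithin_le_nhds
  refine le_of_tendsto ht ?_
  filter_upwards [self_mem_nhdsWithin] with ε hε
  exact (ENNReal.sum_le_tsum s).trans (h ε hε)

theorem resolventSup_eq (A : H →L[ℂ] H) (U : unitary (H →L[ℂ] H)) :
    resolventSup A U = ENNReal.ofReal (2 * Real.pi) * smoothNormSq A U := by
  have hp : ENNReal.ofReal (2 * Real.pi) ≠ 0 := by
    simpa using Real.pi_pos
  apply le_antisymm
  · refine iSup₂_le fun ε hε => iSup₂_le fun φ hφ => ?_
    have key : ∀ ε : ℝ, 0 < ε → resolventNormSq A U ε φ + resolventNormSq A U (-ε) φ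
        ≤ ENNReal.ofReal (2 * Real.pi) * smoothNormSq A U := by
      intro ε hε
      rw [resolventNormSq_add A U hε]
      gcongr
      refine le_trans ?_ (le_iSup₂ φ hφ)
      exact ENNReal.tsum_le_tsum fun t => by gcongr; exact enorm_dampedOrbit_le A U hε.le φ t
    rcases lt_or_gt_of_ne hε with h | h
    · have := key (-ε) (by linarith)
      rwa [neg_neg, add_comm] at this
    · exact key ε h
  · rw [mul_comm, ← ENNReal.le_div_iff_mul_le (Or.inl hp) (Or.inl ENNReal.ofReal_ne_top)]
    refine iSup₂_le fun φ hφ => tsum_enorm_sq_le_of_dampedOrbit A U φ fun ε hε => ?_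
    rw [ENNReal.le_div_iff_mul_le (Or.inl hp) (Or.inl ENNReal.ofReal_ne_top), mul_comm,
      ← resolventNormSq_add A U hε]
    exact le_iSup₂_of_le ε hε.ne' (le_iSup₂_of_le φ hφ le_rfl)

/-! ### Comparison of the orbit sum with the jump. -/

/-- Parseval's identity for the geometric series `∑ (r e^{il})ⁿ Uⁿ φ`. -/
lemma lintegral_enorm_geom_sq (U : unitary (H →L[ℂ] H)) {ε : ℝ} (hε : 0 < ε) (φ : H) :
    ENNReal.ofReal (1 - Real.exp (-ε) ^ 2) * ∫⁻ l in Set.Ico 0 (2 * Real.pi),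
      ‖geom U (Complex.exp (Complex.I * (((1 : ℝ) : ℂ) * (l : ℝ))) * (Real.exp (-ε) : ℂ)) φ‖ₑ ^ 2
      = ENNReal.ofReal (2 * Real.pi) * ‖φ‖ₑ ^ 2 := by
  set r := Real.exp (-ε) with hr
  have hr0 : 0 < r := Real.exp_pos _
  have hr1 : r < 1 := by simpa [hr] using hε
  have hq : r ^ 2 < 1 := by nlinarith
  have hnorm : ∀ n : ℕ, ‖((r ^ n : ℝ) : ℂ) • ((U ^ n : unitary (H →L[ℂ] H)) : H →L[ℂ] H) φ‖
      = r ^ n * ‖φ‖ := fun n => by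
    rw [norm_smul, norm_unitary_apply, Complex.norm_real, Real.norm_of_nonneg (by positivity)]
  rw [lintegral_enorm_sq_eq_of_hasSum (k := fun n : ℕ => (n : ℤ))
    (c := fun n : ℕ => ((r ^ n : ℝ) : ℂ) • ((U ^ n : unitary (H →L[ℂ] H)) : H →L[ℂ] H) φ)
    Nat.cast_injective]
  · have h1 : ∀ n : ℕ, ‖((r ^ n : ℝ) : ℂ) • ((U ^ n : unitary (H →L[ℂ] H)) : H →L[ℂ] H) φ‖ₑ ^ 2
        = ENNReal.ofReal (r ^ 2) ^ n * ‖φ‖ₑ ^ 2 := fun n => by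
      rw [← ofReal_norm, hnorm, ENNReal.ofReal_mul (by positivity), mul_pow, ofReal_norm,
        ← ENNReal.ofReal_pow (by positivity), ← ENNReal.ofReal_pow (by positivity), ← pow_mul,
        ← pow_mul, mul_comm n]
    simp_rw [h1]
    rw [ENNReal.tsum_mul_right, ENNReal.tsum_geometric, ENNReal.ofReal_sub _ (by positivity),
      ENNReal.ofReal_one]
    have h2 : 1 - ENNReal.ofReal (r ^ 2) ≠ 0 := by
      simpa [tsub_eq_zero_iff_le] using hq
    rw [mul_left_comm, ← mul_assoc (1 - _), ENNReal.mul_inv_cancel h2 (by simp), one_mul]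
  · simp_rw [hnorm]
    exact (summable_geometric_of_lt_one hr0.le hr1).mul_right _
  · intro l
    refine (hasSum_geom_apply U (by rw [norm_exp_mul_I_mul]; exact hr1) φ).congr_fun fun n => ?_
    rw [smul_smul, mul_pow, ← Complex.exp_nat_mul]
    congr 2
    · congr 1
      push_cast
      ring
    · push_cast
      rfl

lemma hasSum_resolventOp_sub_conj (A : H →L[ℂ] H) (U : unitary (H →L[ℂ] H)) {ε : ℝ} (hε : 0 < ε)
    (φ : H) (l : ℝ) :
    HasSum (fun t : ℤ => Complex.exp (Complex.I * ((-t : ℤ) : ℂ) * l) • dampedOrbit A U ε φ t)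
      (A ((resolventOp U (l + Complex.I * (ε : ℂ))
        - resolventOp U (starRingEnd ℂ (l + Complex.I * (ε : ℂ)))) φ)) := by
  have h := HasSum.of_nat_of_neg_add_one
    (f := fun t : ℤ => Complex.exp (Complex.I * ((-t : ℤ) : ℂ) * l) • dampedOrbit A U ε φ t)
    (hasSum_resolventOp_lower A U hε φ l) (hasSum_resolventOp_upper A U hε φ l)
  convert h using 1
  rw [sub_apply, map_sub, sub_eq_neg_add]
  simp

/-- The jump on the line Im μ = ε, applied to φ, has the whole damped orbit as Fourier coefficients.
Of the product (1 - r²) A G G* φ, with r = e^{-ε}, the factor A G is estimated uniformly and G* φ in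
mean square. -/
theorem smoothNormSq_le_jumpSup (A : H →L[ℂ] H) (U : unitary (H →L[ℂ] H)) :
    smoothNormSq A U ≤ jumpSup A U := by
  rcases eq_or_ne (jumpSup A U) ⊤ with htop | htop
  · rw [htop]; exact le_top
  have hp : ENNReal.ofReal (2 * Real.pi) ≠ 0 := by
    simpa using Real.pi_pos
  refine iSup₂_le fun φ hφ => tsum_enorm_sq_le_of_dampedOrbit A U φ fun ε hε => ?_
  have hJ := (jumpSup_le_iff A U _).mp le_rfl
  have hr1 : Real.exp (-ε) < 1 := by simpa using hε
  have hr0 := Real.exp_pos (-ε)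
  have hinj : Function.Injective fun t : ℤ => -t := neg_injective
  have hsum : Summable fun t : ℤ => ‖dampedOrbit A U ε φ t‖ :=
    .of_nat_of_neg_add_one (summable_norm_dampedOrbit_nat A U hε φ)
      (summable_norm_dampedOrbit_neg A U hε φ)
  have h1 := lintegral_enorm_sq_eq_of_hasSum hinj hsum
    fun l => hasSum_resolventOp_sub_conj A U hε φ l
  -- The inverse appears because the adjoint of `geom U c` is `geom U⁻¹` at the conjugate of c.
  have h2 := lintegral_enorm_geom_sq U⁻¹ hε φ
  rw [← ENNReal.mul_le_mul_iff_right hp ENNReal.ofReal_ne_top, ← h1]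
  have h3 : ENNReal.ofReal (2 * Real.pi) * jumpSup A U
      = jumpSup A U * (ENNReal.ofReal (2 * Real.pi) * ‖φ‖ₑ ^ 2) := by
    rw [← ofReal_norm, hφ]; simp [mul_comm]
  rw [h3, ← h2, ← mul_assoc]
  rw [← lintegral_const_mul' _ _ (ENNReal.mul_ne_top htop ENNReal.ofReal_ne_top)]
  refine lintegral_mono fun l => ?_
  set μ : ℂ := l + Complex.I * (ε : ℂ) with hμ
  set c' : ℂ := Complex.exp (Complex.I * (((1 : ℝ) : ℂ) * (l : ℝ))) * (Real.exp (-ε) : ℂ)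
    with hc'
  have hn' : ‖c'‖ = Real.exp (-ε) := norm_exp_mul_I_mul ε 1 l
  have hc1 : ‖starRingEnd ℂ c'‖ < 1 := by simpa [hn'] using hr1
  have he : Complex.exp (-(Complex.I * starRingEnd ℂ μ)) = starRingEnd ℂ c' := by
    rw [hc', Complex.ofReal_exp, ← Complex.exp_add, ← Complex.exp_conj]
    congr 1
    simp [hμ]
    linear_combination ε * Complex.I_mul_I
  have h0 : starRingEnd ℂ c' ≠ 0 := by rw [← he]; exact Complex.exp_ne_zero _
  have hJc := hJ _ h0 hc1
  rw [resolventOp_sub_conj U hc1 he, star_geom U hc1, Complex.conj_conj, RCLike.norm_conj, hn']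
  rw [RCLike.norm_conj, hn', ENNReal.ofReal_mul (by nlinarith),
    ENNReal.ofReal_pow (norm_nonneg _), ofReal_norm] at hJc
  set q := 1 - Real.exp (-ε) ^ 2 with hqdef
  have hq : 0 ≤ q := by rw [hqdef]; nlinarith
  have hb : ‖A (((q : ℂ) • (geom U (starRingEnd ℂ c') * geom U⁻¹ c')) φ)‖ₑ
      ≤ ENNReal.ofReal q * (‖A * geom U (starRingEnd ℂ c')‖ₑ * ‖geom U⁻¹ c' φ‖ₑ) := by
    rw [smul_apply, map_smul, enorm_smul, mul_apply_eq_comp, ← ofReal_norm (q : ℂ),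
      Complex.norm_real, Real.norm_of_nonneg hq]
    gcongr
    exact (A * geom U (starRingEnd ℂ c')).le_opENorm _
  -- Of the two factors q = 1 - r², one joins ‖A G‖² to form a quantity bounded by `jumpSup`; the
  -- other normalises the Parseval integral of ‖G* φ‖².
  calc _ ≤ (ENNReal.ofReal q
          * (‖A * geom U (starRingEnd ℂ c')‖ₑ * ‖geom U⁻¹ c' φ‖ₑ)) ^ 2 := by gcongr
    _ = (ENNReal.ofReal q * ‖A * geom U (starRingEnd ℂ c')‖ₑ ^ 2) * ENNReal.ofReal q
          * ‖geom U⁻¹ c' φ‖ₑ ^ 2 := by ring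
    _ ≤ _ := by gcongr

theorem sum_norm_sq_le_smoothNormSq (A : H →L[ℂ] H) (U : unitary (H →L[ℂ] H))
    (h : smoothNormSq A U ≠ ⊤) (φ : H) (s : Finset ℤ) :
    ∑ t ∈ s, ‖A (((U ^ t : unitary (H →L[ℂ] H)) : H →L[ℂ] H) φ)‖ ^ 2
      ≤ (smoothNormSq A U).toReal * ‖φ‖ ^ 2 := by
  have unit : ∀ ψ : H, ‖ψ‖ = 1 →
      ∑ t ∈ s, ‖A (((U ^ t : unitary (H →L[ℂ] H)) : H →L[ℂ] H) ψ)‖ ^ 2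
        ≤ (smoothNormSq A U).toReal := by
    intro ψ hψ
    rw [← ENNReal.ofReal_le_iff_le_toReal h, ENNReal.ofReal_sum_of_nonneg fun t _ => by positivity]
    refine le_trans ?_ (le_iSup₂ ψ hψ)
    refine le_trans (le_of_eq ?_) (ENNReal.sum_le_tsum s)
    exact Finset.sum_congr rfl fun t _ => by
      rw [ENNReal.ofReal_pow (norm_nonneg _), ofReal_norm]
  rcases eq_or_ne φ 0 with rfl | hφ
  · simp
  · have hn : (‖φ‖ : ℂ) ≠ 0 := by simpa using hφ
    have hx : φ = (‖φ‖ : ℂ) • ((‖φ‖ : ℂ)⁻¹ • φ) := by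
      rw [smul_smul, mul_inv_cancel₀ hn, one_smul]
    have hu : ‖(‖φ‖ : ℂ)⁻¹ • φ‖ = 1 := by
      rw [norm_smul, norm_inv, Complex.norm_real, norm_norm]
      exact inv_mul_cancel₀ (by simpa using hφ)
    have h1 := unit _ hu
    have h2 : ∀ t : ℤ, ‖A (((U ^ t : unitary (H →L[ℂ] H)) : H →L[ℂ] H) φ)‖ ^ 2
        = ‖φ‖ ^ 2 * ‖A (((U ^ t : unitary (H →L[ℂ] H)) : H →L[ℂ] H)
          ((‖φ‖ : ℂ)⁻¹ • φ))‖ ^ 2 := fun t => by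
      conv_lhs => rw [hx]
      rw [map_smul, map_smul, norm_smul, Complex.norm_real, norm_norm, mul_pow]
    simp_rw [h2]
    rw [← Finset.mul_sum, mul_comm]
    gcongr

/-- Cauchy-Schwarz for ∑ ‖c‖ⁿ ‖A Uⁿ φ‖: the weights contribute ∑ ‖c‖²ⁿ = (1 - ‖c‖²)⁻¹, which cancels
the Poisson prefactor. Only the forward half of the orbit is used. -/
theorem jumpSup_le_smoothNormSq (A : H →L[ℂ] H) (U : unitary (H →L[ℂ] H)) :
    jumpSup A U ≤ smoothNormSq A U := by
  rcases eq_or_ne (smoothNormSq A U) ⊤ with h | h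
  · rw [h]; exact le_top
  rw [jumpSup_le_iff]
  intro c _ hc
  set S := (smoothNormSq A U).toReal
  have hS : 0 ≤ S := ENNReal.toReal_nonneg
  have hq : 0 < 1 - ‖c‖ ^ 2 := by nlinarith [norm_nonneg c]
  have hgeo : ∀ N : ℕ, ∑ n ∈ Finset.range N, (‖c‖ ^ n) ^ 2 ≤ (1 - ‖c‖ ^ 2)⁻¹ := fun N => by
    simp_rw [← pow_mul, mul_comm _ 2, pow_mul]
    have := (hasSum_geometric_of_lt_one (r := ‖c‖ ^ 2) (by positivity) (by linarith))
    rw [← this.tsum_eq]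
    exact this.summable.sum_le_tsum _ fun n _ => by positivity
  have hbound : ∀ φ : H, ‖(A * geom U c) φ‖ ≤ Real.sqrt ((1 - ‖c‖ ^ 2)⁻¹ * S) * ‖φ‖ := by
    intro φ
    have ht := ((hasSum_geom_apply U hc φ).mapL A).tendsto_sum_nat.norm
    refine le_of_tendsto ht (Filter.Eventually.of_forall fun N => ?_)
    have hsq : Real.sqrt ((1 - ‖c‖ ^ 2)⁻¹ * (S * ‖φ‖ ^ 2))
        = Real.sqrt ((1 - ‖c‖ ^ 2)⁻¹ * S) * ‖φ‖ := by
      rw [← mul_assoc, Real.sqrt_mul (by positivity), Real.sqrt_sq (norm_nonneg _)]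
    rw [← hsq]
    refine (norm_sum_le _ _).trans (Real.le_sqrt_of_sq_le ?_)
    simp_rw [map_smul, norm_smul, norm_pow]
    refine (Finset.sum_mul_sq_le_sq_mul_sq _ _ _).trans ?_
    gcongr
    · exact hgeo N
    · have := sum_norm_sq_le_smoothNormSq A U h φ ((Finset.range N).map Nat.castEmbedding)
      simpa using this
  have hop := ContinuousLinearMap.opNorm_le_bound _ (Real.sqrt_nonneg _) hbound
  rw [ENNReal.ofReal_le_iff_le_toReal h]
  calc (1 - ‖c‖ ^ 2) * ‖A * geom U c‖ ^ 2
      ≤ (1 - ‖c‖ ^ 2) * Real.sqrt ((1 - ‖c‖ ^ 2)⁻¹ * S) ^ 2 := by gcongr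
    _ = S := by
      rw [Real.sq_sqrt (by positivity), ← mul_assoc, mul_inv_cancel₀ hq.ne', one_mul]

/-! ### Spectral measures and idempotence of spectral projections. -/

lemma integral_spectralMeasure_re (U : unitary (H →L[ℂ] H)) (φ : H)
    (f : C(spectrum ℂ (U : H →L[ℂ] H), ℝ)) :
    ∫ z, f z ∂(spectralMeasure U φ) = (⟪φ, contCalc U f φ⟫_ℂ).re := by
  rw [← integral_spectralMeasure, Complex.ofReal_re]

lemma spectralProjection_inner_comm (U : unitary (H →L[ℂ] H)) {E : Set ℂ} (hE : MeasurableSet E)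
    (x y : H) : ⟪spectralProjection U E x, y⟫_ℂ = ⟪x, spectralProjection U E y⟫_ℂ := by
  refine (LinearMap.isSymmetric_iff_inner_map_self_real
    (spectralProjection U E : H →ₗ[ℂ] H)).mpr (fun v => ?_) x y
  have h := inner_spectralProjection U hE v
  have h2 : ⟪spectralProjection U E v, v⟫_ℂ
      = ((spectralMeasure U v).real (Subtype.val ⁻¹' E) : ℂ) := by
    rw [← inner_conj_symm, h, Complex.conj_ofReal]
  simp only [ContinuousLinearMap.coe_coe]
  rw [h2, Complex.conj_ofReal]

lemma re_inner_spectralProjection (U : unitary (H →L[ℂ] H)) {E : Set ℂ} (hE : MeasurableSet E)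
    (x y : H) : 4 * (⟪x, spectralProjection U E y⟫_ℂ).re
      = (spectralMeasure U (x + y)).real (Subtype.val ⁻¹' E)
        - (spectralMeasure U (x - y)).real (Subtype.val ⁻¹' E) := by
  have h1 := congrArg Complex.re (inner_spectralProjection U hE (x + y))
  have h2 := congrArg Complex.re (inner_spectralProjection U hE (x - y))
  rw [Complex.ofReal_re] at h1 h2
  rw [← h1, ← h2]
  have h3 : (⟪y, spectralProjection U E x⟫_ℂ).re = (⟪x, spectralProjection U E y⟫_ℂ).re := by
    rw [← spectralProjection_inner_comm U hE, ← inner_conj_symm, Complex.conj_re]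
  simp only [map_add, map_sub, inner_add_left, inner_add_right, inner_sub_left, inner_sub_right,
    Complex.add_re, Complex.sub_re]
  linarith

/-- Since g(U) is self-adjoint and commutes with the calculus, ⟨g(U)φ, f(U)g(U)φ⟩ = ∫ f g² dμ_φ for
all continuous f. So μ_{g(U)φ} has density g² with respect to μ_φ. -/
lemma spectralMeasure_contCalc_real (U : unitary (H →L[ℂ] H)) (φ : H)
    (g : C(spectrum ℂ (U : H →L[ℂ] H), ℝ)) {E : Set (spectrum ℂ (U : H →L[ℂ] H))}
    (hE : MeasurableSet E) :
    (spectralMeasure U (contCalc U g φ)).real E = ∫ z in E, g z ^ 2 ∂(spectralMeasure U φ) := by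
  have hint : Integrable (fun z => g z ^ 2) (spectralMeasure U φ) :=
    Continuous.integrable_of_hasCompactSupport (by fun_prop) (.of_compactSpace _)
  have hm : Measurable fun z => ENNReal.ofReal (g z ^ 2) :=
    (ENNReal.continuous_ofReal.comp (by fun_prop)).measurable
  have := isFiniteMeasure_withDensity_ofReal hint.hasFiniteIntegral
  have key : spectralMeasure U (contCalc U g φ)
      = (spectralMeasure U φ).withDensity fun z => ENNReal.ofReal (g z ^ 2) := by
    refine ext_of_forall_integral_eq_of_IsFiniteMeasure fun f => ?_
    rw [integral_withDensity_eq_integral_toReal_smul hm (by simp)]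
    have h1 : ∀ z, (ENNReal.ofReal (g z ^ 2)).toReal • f z = (g * f.toContinuousMap * g) z := by
      intro z
      rw [ENNReal.toReal_ofReal (by positivity)]
      simp
      ring
    simp_rw [h1]
    rw [integral_spectralMeasure_re, contCalc_mul, contCalc_mul, mul_apply_eq_comp,
      mul_apply_eq_comp, ← contCalc_inner_comm]
    exact integral_spectralMeasure_re U _ f.toContinuousMap
  rw [key]
  have h2 := setIntegral_withDensity_eq_setIntegral_toReal_smul (μ := spectralMeasure U φ) hm
    (s := E) (by simp) (fun _ => (1 : ℝ)) hE
  rw [setIntegral_const, smul_eq_mul, mul_one] at h2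
  rw [h2]
  refine setIntegral_congr_fun hE fun z _ => ?_
  simp only [smul_eq_mul, mul_one]
  rw [ENNReal.toReal_ofReal (by positivity)]

/-- Polarization, with (f + 1)² - (f - 1)² = 4f for the densities of f(U)φ ± φ. -/
lemma re_inner_contCalc_spectralProjection (U : unitary (H →L[ℂ] H)) (φ : H)
    (f : C(spectrum ℂ (U : H →L[ℂ] H), ℝ)) {E : Set ℂ} (hE : MeasurableSet E) :
    (⟪contCalc U f φ, spectralProjection U E φ⟫_ℂ).re
      = ∫ z in Subtype.val ⁻¹' E, f z ∂(spectralMeasure U φ) := by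
  have hE' : MeasurableSet (Subtype.val ⁻¹' E : Set (spectrum ℂ (U : H →L[ℂ] H))) :=
    measurable_subtype_coe hE
  have h := re_inner_spectralProjection U hE (contCalc U f φ) φ
  have hadd : contCalc U f φ + φ = contCalc U (f + 1) φ := by
    rw [contCalc_add, contCalc_one]; rfl
  have hsub : contCalc U f φ - φ = contCalc U (f + (-1 : ℝ) • 1) φ := by
    rw [contCalc_add, contCalc_smul, contCalc_one]; simp [sub_eq_add_neg]
  have hint : ∀ g : C(spectrum ℂ (U : H →L[ℂ] H), ℝ),
      IntegrableOn (fun z => g z ^ 2) (Subtype.val ⁻¹' E) (spectralMeasure U φ) := fun g =>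
    (Continuous.integrable_of_hasCompactSupport (by fun_prop) (.of_compactSpace _)).integrableOn
  rw [hadd, hsub, spectralMeasure_contCalc_real U φ _ hE', spectralMeasure_contCalc_real U φ _ hE',
    ← integral_sub (hint _) (hint _)] at h
  have h4 : ∀ z, (f + 1) z ^ 2 - (f + (-1 : ℝ) • 1) z ^ 2 = 4 * f z := fun z => by
    simp
    ring
  simp_rw [h4] at h
  rw [integral_const_mul] at h
  linarith

/-- `‖1_E(U) φ‖² = μ_φ(E)`, i.e. `1_E(U)` is idempotent. -/
theorem norm_spectralProjection_sq (U : unitary (H →L[ℂ] H)) {E : Set ℂ} (hE : MeasurableSet E)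
    (φ : H) : ‖spectralProjection U E φ‖ ^ 2
      = (spectralMeasure U φ).real (Subtype.val ⁻¹' E) := by
  have hE' : MeasurableSet (Subtype.val ⁻¹' E : Set (spectrum ℂ (U : H →L[ℂ] H))) :=
    measurable_subtype_coe hE
  set ψ := spectralProjection U E φ with hψ
  -- Tested on continuous f, the difference of the measures at φ ± ψ is 4 Re⟨f(U)φ, ψ⟩ = 4 ∫_E f
  -- dμ_φ. Evaluating on E itself then yields Re⟨φ, 1_E(U)ψ⟩ = μ_φ(E), and the left side is ‖ψ‖² by
  -- symmetry.
  have key : spectralMeasure U (φ + ψ) = spectralMeasure U (φ - ψ)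
      + (4 : NNReal) • (spectralMeasure U φ).restrict (Subtype.val ⁻¹' E) := by
    refine ext_of_forall_integral_eq_of_IsFiniteMeasure fun f => ?_
    have hint : ∀ μ : Measure (spectrum ℂ (U : H →L[ℂ] H)), IsFiniteMeasure μ →
        Integrable f μ := fun μ _ => f.integrable μ
    rw [integral_add_measure (hint _ inferInstance) (hint _ inferInstance),
      integral_smul_nnreal_measure]
    have h0 := re_inner_contCalc_spectralProjection U φ f.toContinuousMap hE
    have h1 := integral_spectralMeasure_re U (φ + ψ) f.toContinuousMap
    have h2 := integral_spectralMeasure_re U (φ - ψ) f.toContinuousMap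
    change ∫ z, f z ∂_ = _ at h1 h2
    change _ = ∫ z in _, f z ∂_ at h0
    rw [h1, h2, ← h0, ← hψ]
    have h3 : (⟪ψ, contCalc U f.toContinuousMap φ⟫_ℂ).re
        = (⟪contCalc U f.toContinuousMap φ, ψ⟫_ℂ).re := by
      rw [← inner_conj_symm, Complex.conj_re]
    have h4 : (⟪φ, contCalc U f.toContinuousMap ψ⟫_ℂ).re
        = (⟪contCalc U f.toContinuousMap φ, ψ⟫_ℂ).re := by
      rw [contCalc_inner_comm]
    simp only [map_add, map_sub, inner_add_left, inner_add_right, inner_sub_left, inner_sub_right,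
      Complex.add_re, Complex.sub_re, NNReal.smul_def, smul_eq_mul, NNReal.coe_ofNat]
    linarith
  have h1 := re_inner_spectralProjection U hE φ ψ
  rw [key, measureReal_add_apply, measureReal_nnreal_smul_apply,
    measureReal_restrict_apply_self] at h1
  rw [← spectralProjection_inner_comm U hE, ← hψ] at h1
  have h2 : (⟪ψ, ψ⟫_ℂ).re = ‖ψ‖ ^ 2 := inner_self_eq_norm_sq (𝕜 := ℂ) ψ
  rw [h2] at h1
  simp at h1
  linarith

/-! ### The Poisson kernel: spectral integrals, normalisation, concentration. -/

/-- The Poisson kernel `(1 - ‖c‖²) / ‖1 - c z‖²`. -/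
noncomputable def poisson (c z : ℂ) : ℝ := (1 - ‖c‖ ^ 2) / ‖1 - c * z‖ ^ 2

lemma norm_of_mem_spectrum (U : unitary (H →L[ℂ] H)) (z : spectrum ℂ (U : H →L[ℂ] H)) :
    ‖(z : ℂ)‖ = 1 := by
  simpa using Unitary.spectrum_subset_circle U z.2

lemma one_sub_mul_ne_zero {c z : ℂ} (hc : ‖c‖ < 1) (hz : ‖z‖ = 1) : 1 - c * z ≠ 0 := by
  intro h
  have : ‖c * z‖ = 1 := by rw [← sub_eq_zero.mp h, norm_one]
  rw [norm_mul, hz, mul_one] at this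
  linarith

lemma poisson_nonneg {c : ℂ} (hc : ‖c‖ < 1) (z : ℂ) : 0 ≤ poisson c z :=
  div_nonneg (by nlinarith [norm_nonneg c]) (by positivity)

/-- The Poisson integral of the spectral measure. -/
theorem integral_poisson_spectralMeasure (U : unitary (H →L[ℂ] H)) {c : ℂ} (hc : ‖c‖ < 1) (φ : H) :
    ∫ z, poisson c z ∂(spectralMeasure U φ) = (1 - ‖c‖ ^ 2) * ‖star (geom U c) φ‖ ^ 2 := by
  have hne : ∀ z : spectrum ℂ (U : H →L[ℂ] H), 1 - c * (z : ℂ) ≠ 0 := fun z =>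
    one_sub_mul_ne_zero hc (norm_of_mem_spectrum U z)
  let p : C(spectrum ℂ (U : H →L[ℂ] H), ℝ) := ⟨fun z => poisson c z, by
    unfold poisson
    exact Continuous.div (by fun_prop) (by fun_prop) fun z => by simpa using hne z⟩
  let q : C(spectrum ℂ (U : H →L[ℂ] H), ℂ) := 1 - c • (ContinuousMap.restrict _ (.id ℂ))
  have hq : cfcHom (R := ℂ) (a := (U : H →L[ℂ] H)) (p := IsStarNormal) inferInstance q
      = 1 - c • (U : H →L[ℂ] H) := by
    rw [map_sub, map_one, map_smul, cfcHom_id]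
  -- In the functional calculus the required operator identity is the pointwise one (1 - cz) P_c(z)
  -- conj(1 - cz) = 1 - ‖c‖².
  have hT : contCalc U p = ((1 - ‖c‖ ^ 2 : ℝ) : ℂ) • (geom U c * star (geom U c)) := by
    apply eq_smul_geom_mul_star U hc
    rw [contCalc, ← hq, ← map_star, ← map_mul, ← map_mul,
      ← map_one (cfcHom (R := ℂ) (a := (U : H →L[ℂ] H)) (p := IsStarNormal) inferInstance),
      ← map_smul]
    congr 1
    ext z
    have hz : ((‖1 - c * (z : ℂ)‖ ^ 2 : ℝ) : ℂ) ≠ 0 := by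
      have := hne z
      exact_mod_cast pow_ne_zero 2 (norm_ne_zero_iff.mpr this)
    have hs : (1 - c * (z : ℂ)) * starRingEnd ℂ (1 - c * (z : ℂ))
        = ((‖1 - c * (z : ℂ)‖ ^ 2 : ℝ) : ℂ) := by
      rw [Complex.mul_conj, Complex.normSq_eq_norm_sq]
    change (1 - c * (z : ℂ)) * ((poisson c z : ℝ) : ℂ) * starRingEnd ℂ (1 - c * (z : ℂ))
      = ((1 - ‖c‖ ^ 2 : ℝ) : ℂ) * 1
    rw [mul_right_comm, hs, poisson, Complex.ofReal_div, mul_div_cancel₀ _ hz, mul_one]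
  have h1 := integral_spectralMeasure_re U φ p
  rw [hT, smul_apply, mul_apply_eq_comp, inner_smul_right, Complex.re_ofReal_mul,
    ← ContinuousLinearMap.adjoint_inner_left, ← ContinuousLinearMap.star_eq_adjoint] at h1
  rw [← inner_self_eq_norm_sq (𝕜 := ℂ) (star (geom U c) φ)]
  exact h1

lemma continuous_poisson_exp {c : ℂ} (hc : ‖c‖ < 1) :
    Continuous fun x : ℝ => poisson c (Complex.exp (Complex.I * x)) := by
  unfold poisson
  refine Continuous.div (by fun_prop) (by fun_prop) fun x => ?_
  have := one_sub_mul_ne_zero hc (Complex.norm_exp_I_mul_ofReal x)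
  simpa using this

lemma periodic_poisson_exp (c : ℂ) :
    Function.Periodic (fun x : ℝ => poisson c (Complex.exp (Complex.I * x))) (2 * Real.pi) := by
  intro x
  have : Complex.I * ((x + 2 * Real.pi : ℝ) : ℂ) = Complex.I * x + 2 * Real.pi * Complex.I := by
    push_cast; ring
  simp only [this, Complex.exp_add, Complex.exp_two_pi_mul_I, mul_one]

lemma poisson_mul (c w z : ℂ) (hw : ‖w‖ = 1) : poisson (c * w) z = poisson c (w * z) := by
  rw [poisson, poisson, norm_mul, hw, mul_one, mul_assoc]

lemma integral_poisson_zero_two_pi {r : ℝ} (h0 : 0 < r) (h1 : r < 1) :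
    ∫ x in (0 : ℝ)..(2 * Real.pi), poisson r (Complex.exp (Complex.I * x)) = 2 * Real.pi := by
  have hε : 0 < -Real.log r := by linarith [Real.log_neg h0 h1]
  have hr : ‖(r : ℂ)‖ < 1 := by rwa [Complex.norm_real, Real.norm_of_nonneg h0.le]
  -- Parseval on the one-dimensional space with U = 1 and e^{-ε} = r: here G is multiplication by
  -- 1/(1 - r e^{il}), and (1 - r²)|G|² is the Poisson kernel.
  have h := lintegral_enorm_geom_sq (1 : unitary (ℂ →L[ℂ] ℂ)) hε 1
  rw [neg_neg, Real.exp_log h0, ← lintegral_const_mul' _ _ ENNReal.ofReal_ne_top, enorm_one,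
    one_pow, mul_one] at h
  have hq : 0 ≤ 1 - r ^ 2 := by nlinarith
  have hpt : ∀ l : ℝ, ENNReal.ofReal (1 - r ^ 2) * ‖geom (1 : unitary (ℂ →L[ℂ] ℂ))
      (Complex.exp (Complex.I * (((1 : ℝ) : ℂ) * (l : ℝ))) * (r : ℂ)) 1‖ₑ ^ 2
      = ENNReal.ofReal (poisson r (Complex.exp (Complex.I * l))) := by
    intro l
    set w := Complex.exp (Complex.I * l) with hw
    have hwn : ‖w‖ = 1 := Complex.norm_exp_I_mul_ofReal l
    have hc : ‖(r : ℂ) * w‖ < 1 := by rw [norm_mul, hwn, mul_one]; exact hr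
    have hg := congrArg (fun T : ℂ →L[ℂ] ℂ => T 1) (mul_geom (1 : unitary (ℂ →L[ℂ] ℂ)) hc)
    have hg' : (1 - r * w) * geom (1 : unitary (ℂ →L[ℂ] ℂ)) (r * w) 1 = 1 := by
      rw [sub_mul, one_mul]
      exact hg
    rw [Complex.ofReal_one, one_mul, ← hw, mul_comm w, eq_inv_of_mul_eq_one_right hg', ← ofReal_norm,
      ← ENNReal.ofReal_pow (norm_nonneg _), ← ENNReal.ofReal_mul hq, poisson, norm_inv, inv_pow,
      Complex.norm_real, Real.norm_of_nonneg h0.le, div_eq_mul_inv]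
  simp_rw [hpt] at h
  rw [intervalIntegral.integral_of_le (by positivity), ← integral_Ico_eq_integral_Ioc,
    integral_eq_lintegral_of_nonneg_ae
      (Filter.Eventually.of_forall fun x => poisson_nonneg hr _)
      (continuous_poisson_exp hr).aestronglyMeasurable, h, ENNReal.toReal_ofReal (by positivity)]

/-- The argument of c only rotates the kernel, and periodicity makes the starting point irrelevant.
-/
theorem integral_poisson {c : ℂ} (h0 : c ≠ 0) (hc : ‖c‖ < 1) (t : ℝ) :
    ∫ x in t..(t + 2 * Real.pi), poisson c (Complex.exp (Complex.I * x)) = 2 * Real.pi := by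
  have hpt : ∀ x : ℝ, poisson c (Complex.exp (Complex.I * x))
      = poisson ‖c‖ (Complex.exp (Complex.I * ((x + c.arg : ℝ) : ℂ))) := by
    intro x
    conv_lhs => rw [← Complex.norm_mul_exp_arg_mul_I c, poisson_mul _ _ _
      (Complex.norm_exp_ofReal_mul_I _), ← Complex.exp_add]
    congr 2
    push_cast
    ring
  simp_rw [hpt]
  rw [intervalIntegral.integral_comp_add_right
    (fun x : ℝ => poisson ‖c‖ (Complex.exp (Complex.I * (x : ℂ)))) c.arg, add_right_comm,
    (periodic_poisson_exp ‖c‖).intervalIntegral_add_eq _ 0, zero_add]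
  exact integral_poisson_zero_two_pi (norm_pos_iff.mpr h0) hc

/-- The denominator is 1 - 2r cos x + r² = (1 - r)² + 2r(1 - cos x), which is at least 2r(1 - cos δ)
outside the window of radius δ. -/
lemma poisson_le {r δ x : ℝ} (h0 : 0 < r) (h1 : r < 1) (hδ : 0 < δ) (hx : δ ≤ |x|)
    (hx' : |x| ≤ Real.pi) :
    poisson r (Complex.exp (Complex.I * x)) ≤ (1 - r ^ 2) / (2 * r * (1 - Real.cos δ)) := by
  have hcos : Real.cos x ≤ Real.cos δ := by
    rw [← Real.cos_abs x]
    exact Real.cos_le_cos_of_nonneg_of_le_pi hδ.le hx' hx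
  have hcos1 : Real.cos δ < 1 := by
    rw [← Real.cos_zero]
    exact Real.cos_lt_cos_of_nonneg_of_le_pi le_rfl (hx.trans hx') hδ
  have hn : ‖1 - (r : ℂ) * Complex.exp (Complex.I * x)‖ ^ 2 = 1 - 2 * r * Real.cos x + r ^ 2 := by
    rw [← Complex.normSq_eq_norm_sq, mul_comm Complex.I, Complex.exp_mul_I, Complex.normSq_apply]
    simp [← Complex.ofReal_cos, ← Complex.ofReal_sin]
    nlinarith [Real.sin_sq_add_cos_sq x]
  rw [poisson, hn, Complex.norm_real, Real.norm_of_nonneg h0.le]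
  refine div_le_div_of_nonneg_left (by nlinarith) (by nlinarith) ?_
  nlinarith [sq_nonneg (1 - r)]

/-- From the total mass 2π subtract two tails, each over an interval of length at most π on which
`poisson_le` applies. -/
lemma le_integral_poisson_near_zero {r δ : ℝ} (h0 : 0 < r) (h1 : r < 1) (hδ : 0 < δ)
    (hδ' : δ ≤ Real.pi) :
    2 * Real.pi - 2 * Real.pi * ((1 - r ^ 2) / (2 * r * (1 - Real.cos δ)))
      ≤ ∫ x in (-δ)..δ, poisson r (Complex.exp (Complex.I * x)) := by
  have hr : ‖(r : ℂ)‖ < 1 := by rwa [Complex.norm_real, Real.norm_of_nonneg h0.le]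
  set f : ℝ → ℝ := fun x => poisson r (Complex.exp (Complex.I * x)) with hf
  set m := (1 - r ^ 2) / (2 * r * (1 - Real.cos δ)) with hm
  have hi : ∀ a b : ℝ, IntervalIntegrable f volume a b := fun a b =>
    (continuous_poisson_exp hr).intervalIntegrable a b
  have htot := integral_poisson (c := r) (by exact_mod_cast h0.ne') hr (-Real.pi)
  rw [show -Real.pi + 2 * Real.pi = Real.pi by ring] at htot
  change ∫ x in _.._, f x = _ at htot
  rw [← intervalIntegral.integral_add_adjacent_intervals (hi _ (-δ)) (hi _ _),
    ← intervalIntegral.integral_add_adjacent_intervals (hi _ δ) (hi _ Real.pi)] at htot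
  have hl : ∫ x in (-Real.pi)..(-δ), f x ≤ ∫ _ in (-Real.pi)..(-δ), m :=
    intervalIntegral.integral_mono_on (by linarith) (hi _ _) (by simp) fun x hx =>
      poisson_le h0 h1 hδ (by rw [abs_of_nonpos (by linarith [hx.2])]; linarith [hx.2])
        (by rw [abs_of_nonpos (by linarith [hx.2])]; linarith [hx.1])
  have hrr : ∫ x in δ..Real.pi, f x ≤ ∫ _ in δ..Real.pi, m :=
    intervalIntegral.integral_mono_on (by linarith) (hi _ _) (by simp) fun x hx =>
      poisson_le h0 h1 hδ (by rw [abs_of_nonneg (by linarith [hx.1])]; linarith [hx.1])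
        (by rw [abs_of_nonneg (by linarith [hx.1])]; linarith [hx.2])
  rw [intervalIntegral.integral_const, smul_eq_mul] at hl hrr
  have hm0 : 0 ≤ m := div_nonneg (by nlinarith)
    (mul_nonneg (by positivity) (by linarith [Real.cos_le_one δ]))
  nlinarith

/-! ### Bounded Poisson integrals give bounded arc masses. -/

/-- Passing to adjoints lets B* act on A*ψ, so that norms of A B are controlled by the spectral
measures at the vectors A*ψ. -/
lemma norm_mul_sq_le_of_star (A B : H →L[ℂ] H) {C : ℝ} (hC : 0 ≤ C)
    (h : ∀ ψ : H, ‖star B (star A ψ)‖ ^ 2 ≤ C * ‖ψ‖ ^ 2) : ‖A * B‖ ^ 2 ≤ C := by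
  rw [← norm_star (A * B), star_mul]
  have : ‖star B * star A‖ ≤ Real.sqrt C := by
    refine ContinuousLinearMap.opNorm_le_bound _ (Real.sqrt_nonneg _) fun ψ => ?_
    rw [mul_apply_eq_comp, ← abs_of_nonneg (norm_nonneg (star B (star A ψ)))]
    refine (Real.abs_le_sqrt (h ψ)).trans_eq ?_
    rw [Real.sqrt_mul hC, Real.sqrt_sq (norm_nonneg _)]
  calc ‖star B * star A‖ ^ 2 ≤ Real.sqrt C ^ 2 := by gcongr
    _ = C := Real.sq_sqrt hC

lemma norm_star_apply_star_apply_sq_le (A B : H →L[ℂ] H) (ψ : H) :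
    ‖star B (star A ψ)‖ ^ 2 ≤ ‖A * B‖ ^ 2 * ‖ψ‖ ^ 2 := by
  rw [← norm_star (A * B), star_mul, ← mul_pow]
  gcongr
  exact (star B * star A).le_opNorm ψ

lemma star_spectralProjection (U : unitary (H →L[ℂ] H)) {E : Set ℂ} (hE : MeasurableSet E) :
    star (spectralProjection U E) = spectralProjection U E := by
  rw [ContinuousLinearMap.star_eq_adjoint, eq_comm, ContinuousLinearMap.eq_adjoint_iff]
  exact spectralProjection_inner_comm U hE

lemma lintegral_poisson_spectralMeasure (U : unitary (H →L[ℂ] H)) {c : ℂ} (hc : ‖c‖ < 1) (φ : H) :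
    ∫⁻ z, ENNReal.ofReal (poisson c z) ∂(spectralMeasure U φ)
      = ENNReal.ofReal ((1 - ‖c‖ ^ 2) * ‖star (geom U c) φ‖ ^ 2) := by
  rw [← integral_poisson_spectralMeasure U hc, ofReal_integral_eq_lintegral_ofReal]
  · refine Continuous.integrable_of_hasCompactSupport ?_ (.of_compactSpace _)
    unfold poisson
    refine Continuous.div (by fun_prop) (by fun_prop) fun z => ?_
    have := one_sub_mul_ne_zero hc (norm_of_mem_spectrum U z)
    simpa using this
  · exact Filter.Eventually.of_forall fun z => poisson_nonneg hc _

/-- A measure whose Poisson integrals are bounded has bounded density on arcs. -/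
lemma measureReal_arc_le {X : Type*} [MeasurableSpace X] (μ : Measure X) [IsFiniteMeasure μ]
    {p : X → ℂ} (hp : Measurable p) {C : ℝ} (hC : 0 ≤ C)
    (h : ∀ c : ℂ, c ≠ 0 → ‖c‖ < 1 → ∫⁻ z, ENNReal.ofReal (poisson c (p z)) ∂μ ≤ ENNReal.ofReal C)
    {a b : ℝ} (hab : a < b) (hb : b ≤ a + 2 * Real.pi) :
    2 * Real.pi * μ.real (p ⁻¹' arc a b) ≤ (b - a) * C := by
  have hE : MeasurableSet (p ⁻¹' arc a b) := hp (measurableSet_arc hb)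
  set M := μ.real (p ⁻¹' arc a b) with hM
  -- Integrate the Poisson integrals centred at e^{il} over l in (a - δ, b + δ] and exchange the
  -- integrals. The widening by δ ensures that each point of the arc sees the full window of radius
  -- δ around the peak.
  have main : ∀ δ : ℝ, 0 < δ → δ ≤ Real.pi → ∀ r : ℝ, 0 < r → r < 1 →
      (2 * Real.pi - 2 * Real.pi * ((1 - r ^ 2) / (2 * r * (1 - Real.cos δ)))) * M
        ≤ (b - a + 2 * δ) * C := by
    intro δ hδ hδ' r h0 h1
    have hr : ‖(r : ℂ)‖ < 1 := by rwa [Complex.norm_real, Real.norm_of_nonneg h0.le]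
    set I := ∫ x in (-δ)..δ, poisson r (Complex.exp (Complex.I * x)) with hI
    have hI0 : 0 ≤ I := intervalIntegral.integral_nonneg (by linarith) fun x _ =>
      poisson_nonneg hr _
    refine (mul_le_mul_of_nonneg_right (le_integral_poisson_near_zero h0 h1 hδ hδ')
      measureReal_nonneg).trans ?_
    have hcl : ∀ l : ℝ, ‖(r : ℂ) * Complex.exp (Complex.I * ((-l : ℝ) : ℂ))‖ < 1 := fun l => by
      rw [norm_mul, Complex.norm_exp_I_mul_ofReal, mul_one]; exact hr
    have hcl0 : ∀ l : ℝ, (r : ℂ) * Complex.exp (Complex.I * ((-l : ℝ) : ℂ)) ≠ 0 := fun l =>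
      mul_ne_zero (by exact_mod_cast h0.ne') (Complex.exp_ne_zero _)
    have upper : ∫⁻ l in Set.Ioc (a - δ) (b + δ), ∫⁻ z, ENNReal.ofReal
        (poisson (r * Complex.exp (Complex.I * ((-l : ℝ) : ℂ))) (p z)) ∂μ
        ≤ ENNReal.ofReal C * ENNReal.ofReal (b - a + 2 * δ) := by
      refine (lintegral_mono fun l => h _ (hcl0 l) (hcl l)).trans_eq ?_
      rw [setLIntegral_const, Real.volume_Ioc]
      congr 2
      ring
    have lower : ENNReal.ofReal I * μ (p ⁻¹' arc a b)
        ≤ ∫⁻ z, (∫⁻ l in Set.Ioc (a - δ) (b + δ), ENNReal.ofReal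
          (poisson (r * Complex.exp (Complex.I * ((-l : ℝ) : ℂ))) (p z))) ∂μ := by
      rw [← setLIntegral_const]
      refine le_trans (setLIntegral_mono_ae' hE (Filter.Eventually.of_forall fun z hz => ?_))
        (setLIntegral_le_lintegral _ _)
      obtain ⟨θ, hθ, hz⟩ := hz
      simp only at hz
      have hpt : ∀ l : ℝ, poisson (r * Complex.exp (Complex.I * ((-l : ℝ) : ℂ))) (p z)
          = poisson r (Complex.exp (Complex.I * ((θ - l : ℝ) : ℂ))) := fun l => by
        rw [← hz, poisson_mul _ _ _ (Complex.norm_exp_I_mul_ofReal _), ← Complex.exp_add]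
        congr 2
        push_cast
        ring
      simp_rw [hpt]
      have hsub : Set.Ioc (θ - δ) (θ + δ) ⊆ Set.Ioc (a - δ) (b + δ) :=
        Set.Ioc_subset_Ioc (by linarith [hθ.1]) (by linarith [hθ.2])
      refine le_trans (le_of_eq ?_) (lintegral_mono_set hsub)
      have hcont : Continuous fun l : ℝ => poisson r (Complex.exp (Complex.I * ((θ - l : ℝ) : ℂ))) :=
        (continuous_poisson_exp hr).comp (continuous_const.sub continuous_id)
      rw [← ofReal_integral_eq_lintegral_ofReal, ← intervalIntegral.integral_of_le (by linarith),
        intervalIntegral.integral_comp_sub_left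
          (fun x : ℝ => poisson r (Complex.exp (Complex.I * (x : ℂ)))) θ, hI]
      · congr 2 <;> ring
      · exact hcont.integrableOn_Ioc
      · exact Filter.Eventually.of_forall fun l => poisson_nonneg hr _
    rw [lintegral_lintegral_swap] at upper
    · have hle := lower.trans upper
      rw [← ENNReal.ofReal_toReal (measure_ne_top μ (p ⁻¹' arc a b)), ← ENNReal.ofReal_mul hI0,
        ← ENNReal.ofReal_mul hC, ENNReal.ofReal_le_ofReal_iff
          (mul_nonneg hC (by linarith))] at hle
      rw [mul_comm _ C]
      exact hle
    · refine Measurable.aemeasurable ?_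
      unfold poisson Function.uncurry
      fun_prop
  -- For fixed δ, letting r → 1 makes the tail bound vanish; letting δ → 0 afterwards removes the
  -- widening.
  have step : ∀ δ : ℝ, 0 < δ → δ ≤ Real.pi → 2 * Real.pi * M ≤ (b - a + 2 * δ) * C := by
    intro δ hδ hδ'
    have hcos1 : Real.cos δ < 1 := by
      rw [← Real.cos_zero]
      exact Real.cos_lt_cos_of_nonneg_of_le_pi le_rfl hδ' hδ
    have hcont : ContinuousAt (fun r : ℝ => (2 * Real.pi - 2 * Real.pi *
        ((1 - r ^ 2) / (2 * r * (1 - Real.cos δ)))) * M) 1 := by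
      have : (2 : ℝ) * 1 * (1 - Real.cos δ) ≠ 0 := by
        have := sub_pos.mpr hcos1; positivity
      fun_prop (disch := assumption)
    have ht := hcont.tendsto.mono_left (nhdsWithin_le_nhds (s := Set.Iio 1))
    simp only [one_pow, sub_self, zero_div, mul_zero, sub_zero] at ht
    refine le_of_tendsto ht ?_
    filter_upwards [self_mem_nhdsWithin, nhdsWithin_le_nhds (lt_mem_nhds one_pos)] with r h1 h0
    exact main δ hδ hδ' r h0 h1
  have hcont : Continuous fun δ : ℝ => (b - a + 2 * δ) * C := by fun_prop
  have ht := (hcont.tendsto 0).mono_left (nhdsWithin_le_nhds (s := Set.Ioi 0))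
  rw [mul_zero, add_zero] at ht
  refine ge_of_tendsto ht ?_
  filter_upwards [self_mem_nhdsWithin, nhdsWithin_le_nhds (gt_mem_nhds Real.pi_pos)] with δ h0 h1
  exact step δ h0 h1.le

theorem arcSup_le (A : H →L[ℂ] H) (U : unitary (H →L[ℂ] H)) :
    arcSup A U ≤ ENNReal.ofReal (1 / (2 * Real.pi)) * jumpSup A U := by
  have hp : ENNReal.ofReal (1 / (2 * Real.pi)) ≠ 0 := by
    simpa using Real.pi_pos
  rcases eq_or_ne (jumpSup A U) ⊤ with htop | htop
  · rw [htop, ENNReal.mul_top hp]; exact le_top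
  set C := (jumpSup A U).toReal with hCdef
  have hC : 0 ≤ C := ENNReal.toReal_nonneg
  have hJC : jumpSup A U = ENNReal.ofReal C := (ENNReal.ofReal_toReal htop).symm
  refine iSup₂_le fun a b => iSup₂_le fun hab hb => ?_
  have hE := measurableSet_arc hb
  have hpos : 0 < b - a := sub_pos.mpr hab
  have hbound : ‖A * spectralProjection U (arc a b)‖ ^ 2 ≤ 1 / (2 * Real.pi) * C * (b - a) := by
    refine norm_mul_sq_le_of_star A _ (by positivity) fun ψ => ?_
    rw [star_spectralProjection U hE, norm_spectralProjection_sq U hE]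
    have h := measureReal_arc_le (spectralMeasure U (star A ψ)) measurable_subtype_coe
      (C := C * ‖ψ‖ ^ 2) (by positivity) (fun c h0 hc => ?_) hab hb
    · have hpi := Real.pi_pos
      have : (spectralMeasure U (star A ψ)).real (Subtype.val ⁻¹' arc a b)
          ≤ ((b - a) * (C * ‖ψ‖ ^ 2)) / (2 * Real.pi) := by
        rw [le_div_iff₀ (by positivity), mul_comm]; exact h
      refine this.trans_eq ?_
      ring
    · rw [lintegral_poisson_spectralMeasure U hc]
      have h1 := (jumpSup_le_iff A U _).mp le_rfl c h0 hc
      rw [ENNReal.ofReal_le_iff_le_toReal htop] at h1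
      refine ENNReal.ofReal_le_ofReal ?_
      have hq : 0 ≤ 1 - ‖c‖ ^ 2 := by nlinarith [norm_nonneg c]
      calc _ ≤ (1 - ‖c‖ ^ 2) * (‖A * geom U c‖ ^ 2 * ‖ψ‖ ^ 2) := by
            gcongr; exact norm_star_apply_star_apply_sq_le A _ ψ
        _ ≤ C * ‖ψ‖ ^ 2 := by rw [← mul_assoc]; gcongr
  rw [ENNReal.div_le_iff (by simpa using hab) ENNReal.ofReal_ne_top, hJC, ← ofReal_norm,
    ← ENNReal.ofReal_pow (norm_nonneg _), ← ENNReal.ofReal_mul (by positivity),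
    ← ENNReal.ofReal_mul (by positivity)]
  exact ENNReal.ofReal_le_ofReal hbound

/-! ### Bounded arc masses give bounded Poisson integrals. -/

/-- A measure on `ℝ` bounded by a multiple of the length on intervals is bounded by that multiple
of Lebesgue measure. -/
lemma measure_le_smul_volume {ν : Measure ℝ} {K : ℝ≥0∞} (hK : K ≠ ⊤)
    (h : ∀ a b : ℝ, ν (Set.Ioc a b) ≤ K * ENNReal.ofReal (b - a)) : ν ≤ K • volume := by
  rcases eq_or_ne K 0 with rfl | hK0
  · have hcover : (Set.univ : Set ℝ) = ⋃ n : ℕ, Set.Ioc (-(n : ℝ)) n := by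
      refine (Set.eq_univ_of_forall fun x => Set.mem_iUnion.mpr ?_).symm
      obtain ⟨n, hn⟩ := exists_nat_gt |x|
      exact ⟨n, (abs_lt.mp hn).1, (abs_lt.mp hn).2.le⟩
    have hnull : ν Set.univ = 0 := by
      rw [hcover, measure_iUnion_null_iff]
      exact fun n => by simpa using h (-(n : ℝ)) n
    rw [Measure.measure_univ_eq_zero.mp hnull]
    exact Measure.zero_le _
  -- Lebesgue outer measure is the largest outer measure dominated by interval length. Scaling the
  -- infimum that defines this length needs K to be nonzero and finite, hence the separate case K =
  -- 0.
  have h1 : ν.toOuterMeasure ≤ K • StieltjesFunction.id.outer := by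
    rw [StieltjesFunction.outer, OuterMeasure.smul_ofFunction hK, OuterMeasure.le_ofFunction]
    intro s
    rw [Pi.smul_apply, StieltjesFunction.length_eq, smul_eq_mul]
    simp_rw [ENNReal.mul_iInf_of_ne hK0 hK]
    refine le_iInf₂ fun a b => le_iInf fun hs => ?_
    refine (measure_mono fun x hx => hs ⟨hx, ?_⟩).trans (h a b)
    exact notMem_botSet_of_lt (sub_one_lt x)
  intro s
  refine (h1 s).trans_eq ?_
  rw [Real.volume_eq_stieltjes_id, StieltjesFunction.measure]
  rfl

lemma exp_I_mul_arg {z : ℂ} (hz : ‖z‖ = 1) : Complex.exp (Complex.I * z.arg) = z := by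
  have := Complex.norm_mul_exp_arg_mul_I z
  rwa [hz, Complex.ofReal_one, one_mul, mul_comm] at this

/-- A measure on the circle with bounded density on arcs has bounded Poisson integrals. -/
lemma lintegral_poisson_le {X : Type*} [MeasurableSpace X] (μ : Measure X) [IsFiniteMeasure μ]
    {p : X → ℂ} (hp : Measurable p) (hp1 : ∀ x, ‖p x‖ = 1) {K : ℝ} (hK : 0 ≤ K)
    (h : ∀ a b : ℝ, a < b → b ≤ a + 2 * Real.pi → μ.real (p ⁻¹' arc a b) ≤ K * (b - a))
    {c : ℂ} (h0 : c ≠ 0) (hc : ‖c‖ < 1) :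
    ∫⁻ x, ENNReal.ofReal (poisson c (p x)) ∂μ ≤ ENNReal.ofReal (2 * Real.pi * K) := by
  -- The argument unrolls the circle to (-π, π], so that the arc bounds become a comparison of the
  -- pushed-forward measure with Lebesgue measure.
  set q : X → ℝ := fun x => (p x).arg with hq
  have hqm : Measurable q := Complex.measurable_arg.comp hp
  have harc : ∀ a b : ℝ, q ⁻¹' Set.Ico a b ⊆ p ⁻¹' arc a b := fun a b x hx =>
    ⟨q x, hx, exp_I_mul_arg (hp1 x)⟩
  have hreal : ∀ s : Set X, μ s = ENNReal.ofReal (μ.real s) := fun s =>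
    (ENNReal.ofReal_toReal (measure_ne_top μ s)).symm
  have huniv : μ.real Set.univ ≤ K * (2 * Real.pi) := by
    have hpi := Real.pi_pos
    have h1 := h (-Real.pi) Real.pi (by linarith) (by linarith)
    have h2 : p ⁻¹' arc (-Real.pi) Real.pi = Set.univ := by
      refine Set.eq_univ_of_forall fun x => ?_
      rcases (Complex.arg_le_pi (p x)).lt_or_eq with hlt | heq
      · exact ⟨(p x).arg, ⟨(Complex.neg_pi_lt_arg _).le, hlt⟩, exp_I_mul_arg (hp1 x)⟩
      -- The half-open arc omits the angle π, which is represented by -π.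
      · refine ⟨-Real.pi, ⟨le_rfl, by linarith⟩, ?_⟩
        rw [← exp_I_mul_arg (hp1 x), heq]
        simp [mul_comm Complex.I, Complex.exp_neg]
    rw [h2] at h1
    exact h1.trans_eq (by ring)
  have hν : μ.map q ≤ ENNReal.ofReal K • volume := by
    refine measure_le_smul_volume ENNReal.ofReal_ne_top fun a b => ?_
    rcases le_or_gt b a with hba | hab
    · simp [Set.Ioc_eq_empty (not_lt.mpr hba)]
    rw [Measure.map_apply hqm measurableSet_Ioc, ← ENNReal.ofReal_mul hK, hreal]
    apply ENNReal.ofReal_le_ofReal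
    -- Intervals of length at least 2π are covered by the total mass. A shorter (a, b] is enlarged
    -- to [a, b + δ), still of length at most 2π, and δ → 0.
    rcases le_or_gt (2 * Real.pi) (b - a) with hlong | hshort
    · refine (measureReal_mono (Set.subset_univ _)).trans (huniv.trans ?_)
      gcongr
    · have hcont : Continuous fun δ : ℝ => K * (b + δ - a) := by fun_prop
      have ht := (hcont.tendsto 0).mono_left (nhdsWithin_le_nhds (s := Set.Ioi 0))
      rw [add_zero] at ht
      refine ge_of_tendsto ht ?_
      filter_upwards [self_mem_nhdsWithin, nhdsWithin_le_nhds
        (gt_mem_nhds (show (0 : ℝ) < 2 * Real.pi - (b - a) by linarith))] with δ hδ hδ'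
      have hδ0 : 0 < δ := hδ
      refine le_trans (measureReal_mono ?_) (h a (b + δ) (by linarith) (by linarith))
      have hsub : Set.Ioc a b ⊆ Set.Ico a (b + δ) := fun x hx => ⟨hx.1.le, by linarith [hx.2]⟩
      exact (Set.preimage_mono hsub).trans (harc a (b + δ))
  have hg : Measurable fun x : ℝ => ENNReal.ofReal (poisson c (Complex.exp (Complex.I * x))) :=
    (continuous_poisson_exp hc).measurable.ennreal_ofReal
  have hpi := Real.pi_pos
  calc ∫⁻ x, ENNReal.ofReal (poisson c (p x)) ∂μ
      = ∫⁻ x, (Set.Ioc (-Real.pi) Real.pi).indicator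
          (fun t : ℝ => ENNReal.ofReal (poisson c (Complex.exp (Complex.I * t)))) (q x) ∂μ := by
        refine lintegral_congr fun x => ?_
        have hmem : q x ∈ Set.Ioc (-Real.pi) Real.pi :=
          ⟨Complex.neg_pi_lt_arg _, Complex.arg_le_pi _⟩
        rw [Set.indicator_of_mem hmem, exp_I_mul_arg (hp1 x)]
    _ = ∫⁻ t in Set.Ioc (-Real.pi) Real.pi,
          ENNReal.ofReal (poisson c (Complex.exp (Complex.I * t))) ∂(μ.map q) := by
        rw [← lintegral_map (hg.indicator measurableSet_Ioc) hqm,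
          lintegral_indicator measurableSet_Ioc]
    _ ≤ ∫⁻ t in Set.Ioc (-Real.pi) Real.pi,
          ENNReal.ofReal (poisson c (Complex.exp (Complex.I * t))) ∂(ENNReal.ofReal K • volume) :=
        lintegral_mono' (Measure.restrict_mono_measure hν _) le_rfl
    _ = ENNReal.ofReal (2 * Real.pi * K) := by
        have hint := integral_poisson h0 hc (-Real.pi)
        rw [show -Real.pi + 2 * Real.pi = Real.pi by ring,
          intervalIntegral.integral_of_le (by linarith)] at hint
        rw [Measure.restrict_smul, lintegral_smul_measure, ← ofReal_integral_eq_lintegral_ofReal,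
          hint, smul_eq_mul, ← ENNReal.ofReal_mul hK, mul_comm K]
        · exact (continuous_poisson_exp hc).integrableOn_Ioc
        · exact Filter.Eventually.of_forall fun t => poisson_nonneg hc _

theorem le_arcSup (A : H →L[ℂ] H) (U : unitary (H →L[ℂ] H)) :
    ENNReal.ofReal (1 / (2 * Real.pi)) * jumpSup A U ≤ arcSup A U := by
  have hpi := Real.pi_pos
  rcases eq_or_ne (arcSup A U) ⊤ with htop | htop
  · rw [htop]; exact le_top
  set K := (arcSup A U).toReal with hKdef
  have hK : 0 ≤ K := ENNReal.toReal_nonneg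
  have hKe : arcSup A U = ENNReal.ofReal K := (ENNReal.ofReal_toReal htop).symm
  have hJ : jumpSup A U ≤ ENNReal.ofReal (2 * Real.pi * K) := by
    rw [jumpSup_le_iff]
    intro c h0 hc
    have hq : 0 < 1 - ‖c‖ ^ 2 := by nlinarith [norm_nonneg c]
    apply ENNReal.ofReal_le_ofReal
    rw [mul_comm, ← le_div_iff₀ hq]
    refine norm_mul_sq_le_of_star A _ (by positivity) fun ψ => ?_
    rw [div_mul_eq_mul_div, le_div_iff₀ hq, mul_comm]
    have h := lintegral_poisson_le (spectralMeasure U (star A ψ)) measurable_subtype_coe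
      (norm_of_mem_spectrum U) (K := K * ‖ψ‖ ^ 2) (by positivity) (fun a b hab hb => ?_) h0 hc
    · rw [lintegral_poisson_spectralMeasure U hc,
        ENNReal.ofReal_le_ofReal_iff (by positivity)] at h
      exact h.trans_eq (by ring)
    · have hE := measurableSet_arc hb
      have hpos : 0 < b - a := sub_pos.mpr hab
      have h1 : ‖A * spectralProjection U (arc a b)‖ₑ ^ 2 / ENNReal.ofReal (b - a) ≤ arcSup A U :=
        le_iSup₂_of_le a b (le_iSup₂_of_le hab hb le_rfl)
      rw [ENNReal.div_le_iff (by simpa using hab) ENNReal.ofReal_ne_top, hKe, ← ofReal_norm,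
        ← ENNReal.ofReal_pow (norm_nonneg _), ← ENNReal.ofReal_mul hK,
        ENNReal.ofReal_le_ofReal_iff (by positivity)] at h1
      rw [← norm_spectralProjection_sq U hE]
      have h2 := norm_star_apply_star_apply_sq_le A (spectralProjection U (arc a b)) ψ
      rw [star_spectralProjection U hE] at h2
      refine h2.trans ?_
      calc _ ≤ K * (b - a) * ‖ψ‖ ^ 2 := by gcongr
        _ = _ := by ring
  rw [hKe]
  refine (mul_le_mul_right hJ _).trans_eq ?_
  rw [← ENNReal.ofReal_mul (by positivity)]
  congr 1
  field_simp

end KatoUnitary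

/-! ### Assembly of the equalities. -/

theorem theorem2 {H : Type*} [NormedAddCommGroup H] [InnerProductSpace ℂ H] [CompleteSpace H]
    (A : H →L[ℂ] H) (U : unitary (H →L[ℂ] H)) :
    ENNReal.ofReal (1 / (2 * Real.pi)) * KatoUnitary.smoothNormSq A U
        = ENNReal.ofReal (1 / (4 * Real.pi ^ 2)) * KatoUnitary.resolventSup A U ∧
    ENNReal.ofReal (1 / (4 * Real.pi ^ 2)) * KatoUnitary.resolventSup A U
        = ENNReal.ofReal (1 / (2 * Real.pi)) * KatoUnitary.jumpSup A U ∧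
    ENNReal.ofReal (1 / (2 * Real.pi)) * KatoUnitary.jumpSup A U
        = KatoUnitary.arcSup A U := by
  have hSJ : KatoUnitary.smoothNormSq A U = KatoUnitary.jumpSup A U :=
    le_antisymm (KatoUnitary.smoothNormSq_le_jumpSup A U)
      (KatoUnitary.jumpSup_le_smoothNormSq A U)
  have hRS : ENNReal.ofReal (1 / (4 * Real.pi ^ 2)) * KatoUnitary.resolventSup A U
      = ENNReal.ofReal (1 / (2 * Real.pi)) * KatoUnitary.smoothNormSq A U := by
    have hpi := Real.pi_pos
    rw [KatoUnitary.resolventSup_eq, ← mul_assoc, ← ENNReal.ofReal_mul (by positivity)]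
    congr 2
    field_simp
    norm_num
  refine ⟨hRS.symm, ?_, le_antisymm (KatoUnitary.le_arcSup A U) (KatoUnitary.arcSup_le A U)⟩
  rw [hRS, hSJ]
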